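/- Let $\mu,\lambda,L,T>0$, $a\in\mathbb R$, and let $u$ be a solution, smooth on $\mathbb R\times[0,T]$, of $$u_t-\mu u_{xxt}+uu_x+u_x-\lambda u_{xx}=0\quad (x\in\mathbb R,\ 0<t\le T),\qquad u(x+L,t)=u(x,t),\qquad u(x,0)=\phi(x).$$ *Grids and notation.* For positive integers $M,N_c,\beta$ put $N_f=\beta N_c$, $h=L/M$, $\tau_c=T/N_c$, $\tau_f=T/N_f$, $x_p=a+ph$. Grid functions $(v_p)_{p\in\mathbb Z}$ are $M$-periodic in $p$. Put $$\delta_xv_{p-\frac12}=\tfrac{v_p-v_{p-1}}h,\quad \delta_{xx}v_p=\tfrac{v_{p+1}-2v_p+v_{p-1}}{h^2},\quad \Delta_xv_p=\tfrac{v_{p+1}-v_{p-1}}{2h},\quad \Psi(v,w)_p=\tfrac13\big[v_p\Delta_xw_p+\Delta_x(vw)_p\big],$$ $$v^{l-\frac12}=\tfrac12(v^l+v^{l-1}),\quad \delta_t^\eta v^{l-\frac12}=\tfrac{v^l-v^{l-1}}{\tau_\eta}\ (\eta=c,f),$$ $$\|v\|^2=h\sum_{p=1}^Mv_p^2,\quad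 |v|_1^2=h\sum_{p=1}^M(\delta_xv_{p-\frac12})^2,\quad \|v\|_\infty=\max_{1\le p\le M}|v_p|.$$ *Scheme.* Step I: $(u_c,w_c)$ solves, for $1\le q\le N_c$, $$\delta_t^cu_c^{q-\frac12}-\mu\delta_t^cw_c^{q-\frac12}+\Psi(u_c^{q-\frac12},u_c^{q-\frac12})-\tfrac{h^2}2\Psi(w_c^{q-\frac12},u_c^{q-\frac12})+\Delta_xu_c^{q-\frac12}-\tfrac{h^2}6\Delta_xw_c^{q-\frac12}-\lambda w_c^{q-\frac12}=0,$$ with $w_c^q=\delta_{xx}u_c^q-\frac{h^2}{12}\delta_{xx}w_c^q$ for $0\le q\le N_c$ and $(u_c)^0_p=\phi(x_p)$. Step II: $u_f^{(q-1)\beta+r}=(1-\frac r\beta)u_c^{q-1}+\frac r\beta u_c^q$ for $1\le q\le N_c$, $0\le r\le\beta$, and $w_f^k=\delta_{xx}u_f^k-\frac{h^2}{12}\delta_{xx}w_f^k$ for $0\le k\le N_f$. Step III: $(u^k,w^k)$ solves, for $1\le k\le N_f$, $$\delta_t^fu^{k-\frac12}-\mu\delta_t^fw^{k-\frac12}+\Psi(u_f^{k-\frac12},u^{k-\frac12})-\tfrac{h^2}2\Psi(w_f^{k-\frac12},u^{k-\frac12})+\Delta_xu^{k-\frac12}-\tfrac{h^2}6\Delta_xw^{k-\frac12}-\lambda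 w^{k-\frac12}=0,$$ with $w^k=\delta_{xx}u^k-\frac{h^2}{12}\delta_{xx}w^k$ for $0\le k\le N_f$ and $u^0_p=\phi(x_p)$. *Constants.* Let $e^k_p=u(x_p,k\tau_f)-u^k_p$, let $C_0$ be the maximum of $|u|,|u_x|,|u_{xx}|,|u_{xxx}|$ over $\mathbb R\times[0,T]$, and for $\widetilde C>0$ let $$C_3=\max\Big\{\tfrac{10C_0^2}{9\lambda}+\tfrac{5C_0^2L^2}{108\lambda}+\tfrac{20\widetilde C^2}{9\lambda}+\tfrac{5\widetilde C^2L^2}{27\mu\lambda}+\tfrac1\lambda,\ \tfrac3\lambda\Big\}.$$ Call $\widetilde C$ admissible for given $M,N_c,\beta$ and a given Step II solution $(u_f,w_f)$ if, for all $0\le k\le N_f$, $$\max_{1\le p\le M}|u(x_p,k\tau_f)-(u_f)^k_p|\le\widetilde C,\qquad \max_{1\le p\le M}|u_{xx}(x_p,k\tau_f)-(w_f)^k_p|\le \frac{6\widetilde C}{h^2}.$$ **Theorem.** (i) There is a constant $\widetilde C>0$ that is admissible for all $M,N_c,\beta$ and all solutions of Steps I and II. (ii) For every $\widetilde C>0$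 there is a constant $C>0$, independent of $M,N_c,\beta$ (that is, of $h,\tau_c,\tau_f$), such that for all $M,N_c,\beta$ and all solutions of Steps I–III for which $\widetilde C$ is admissible, if $2\tau_fC_3<\frac13$, then for all $0\le k\le N_f$ $$|e^k|_1\le C(\tau_c^2+\tau_f^2+h^4),\quad \|e^k\|\le\frac{LC}{\sqrt6}(\tau_c^2+\tau_f^2+h^4),\quad \|e^k\|_\infty\le\frac{C\sqrt L}2(\tau_c^2+\tau_f^2+h^4).$$ -/

import Mathlib

noncomputable section

namespace BBMB

open scoped ContDiff

/-! ### Grid functions, difference operators and discrete norms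

A spatial grid function is a map `ℤ → ℝ` which is periodic with period `M`; a space-time grid
function is a map `v : ℕ → ℤ → ℝ`, with `v l p` the value at time level `l` and space index `p`. -/

/-- Membership in the space of `M`-periodic grid functions. -/
def IsPeriodicGrid (M : ℕ) (v : ℤ → ℝ) : Prop :=
  ∀ p : ℤ, v (p + M) = v p

/-- The backward difference quotient `δ_x v_{p - 1/2}`. -/
def deltaHalf (h : ℝ) (v : ℤ → ℝ) (p : ℤ) : ℝ :=
  (v p - v (p - 1)) / h

/-- The second difference quotient `δ_xx v_p`. -/
def deltaXX (h : ℝ) (v : ℤ → ℝ) (p : ℤ) : ℝ :=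
  (deltaHalf h v (p + 1) - deltaHalf h v p) / h

/-- The centred difference quotient `Δ_x v_p`. -/
def centralDiff (h : ℝ) (v : ℤ → ℝ) (p : ℤ) : ℝ :=
  (v (p + 1) - v (p - 1)) / (2 * h)

/-- The bilinear operator `Ψ(v, w)_p`. -/
def psi (h : ℝ) (v w : ℤ → ℝ) (p : ℤ) : ℝ :=
  (v p * centralDiff h w p + centralDiff h (fun q => v q * w q) p) / 3

/-- The average of the time levels `l` and `l + 1`, that is, the value at level `(l + 1) - 1/2`. -/
def timeAvg (v : ℕ → ℤ → ℝ) (l : ℕ) (p : ℤ) : ℝ :=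
  (v (l + 1) p + v l p) / 2

/-- The time difference quotient between levels `l` and `l + 1`, that is, at `(l + 1) - 1/2`. -/
def timeDiff (τ : ℝ) (v : ℕ → ℤ → ℝ) (l : ℕ) (p : ℤ) : ℝ :=
  (v (l + 1) p - v l p) / τ

/-- The discrete inner product `⟨v, w⟩`. -/
def gridInner (M : ℕ) (h : ℝ) (v w : ℤ → ℝ) : ℝ :=
  h * ∑ p ∈ Finset.Icc (1 : ℤ) M, v p * w p

/-- The discrete `L²` norm. -/
def normL2 (M : ℕ) (h : ℝ) (v : ℤ → ℝ) : ℝ :=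
  Real.sqrt (gridInner M h v v)

/-- The discrete `H¹` seminorm `|v|₁`. -/
def seminormH1 (M : ℕ) (h : ℝ) (v : ℤ → ℝ) : ℝ :=
  Real.sqrt (gridInner M h (deltaHalf h v) (deltaHalf h v))

/-- The discrete maximum norm (the set is finite, and nonempty for `1 ≤ M`). -/
def normMax (M : ℕ) (v : ℤ → ℝ) : ℝ :=
  sSup ((fun p : ℤ => |v p|) '' Set.Icc (1 : ℤ) M)

/-! ### The initial-boundary value problem -/

/-- The `j`-th partial derivative in space of `u` at `(x, t)`. -/
def dx (j : ℕ) (u : ℝ → ℝ → ℝ) (x t : ℝ) : ℝ :=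
  iteratedDeriv j (fun y => u y t) x

/-- The partial derivative in time on `[0, T]` (one-sided at the end points). -/
def dt (T : ℝ) (u : ℝ → ℝ → ℝ) (x t : ℝ) : ℝ :=
  derivWithin (fun s => u x s) (Set.Icc 0 T) t

/-- `u` is a solution, smooth on `ℝ × [0, T]`, of
`u_t - μ u_xxt + u u_x + u_x - lam u_xx = 0` with spatial period `L` and initial value `φ`. -/
structure IsSmoothSolution (μ lam L T : ℝ) (φ : ℝ → ℝ) (u : ℝ → ℝ → ℝ) : Prop where
  smooth : ContDiffOn ℝ ∞ (fun z : ℝ × ℝ => u z.1 z.2) (Set.univ ×ˢ Set.Icc (0 : ℝ) T)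
  periodic : ∀ x : ℝ, ∀ t ∈ Set.Ioc (0 : ℝ) T, u (x + L) t = u x t
  initial : ∀ x : ℝ, u x 0 = φ x
  pde : ∀ x : ℝ, ∀ t ∈ Set.Ioc (0 : ℝ) T,
    dt T u x t - μ * dt T (dx 2 u) x t + u x t * dx 1 u x t + dx 1 u x t - lam * dx 2 u x t = 0

/-- The restriction of a function of `(x, t)` to the grid points `(a + p h, l τ)`. -/
def restrict (a h τ : ℝ) (u : ℝ → ℝ → ℝ) (l : ℕ) (p : ℤ) : ℝ :=
  u (a + p * h) (l * τ)

/-! ### The three steps of the temporal two-grid compact difference scheme -/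

/-- The relation `w_p = δ_xx v_p - (h²/12) δ_xx w_p` for `1 ≤ p ≤ M`. -/
def CompactRelation (M : ℕ) (h : ℝ) (v w : ℤ → ℝ) : Prop :=
  ∀ p ∈ Set.Icc (1 : ℤ) M, w p = deltaXX h v p - h ^ 2 / 12 * deltaXX h w p

/-- The left-hand side of the Crank-Nicolson compact scheme at `(p, (l + 1) - 1/2)`, where `(v, z)`
is the first argument of `Ψ`. -/
def schemeLHS (μ lam τ h : ℝ) (v z u w : ℕ → ℤ → ℝ) (l : ℕ) (p : ℤ) : ℝ :=
  timeDiff τ u l p - μ * timeDiff τ w l p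
    + psi h (timeAvg v l) (timeAvg u l) p
    - h ^ 2 / 2 * psi h (timeAvg z l) (timeAvg u l) p
    + centralDiff h (timeAvg u l) p
    - h ^ 2 / 6 * centralDiff h (timeAvg w l) p
    - lam * timeAvg w l p

/-- `(u, w)` solves the scheme with time step `τ`, space step `h`, `M` space nodes and `N` time
steps, with `(v, z)` in the first argument of `Ψ`, and with initial value `φ`. -/
structure SolvesScheme (μ lam a τ h : ℝ) (M N : ℕ) (φ : ℝ → ℝ) (v z u w : ℕ → ℤ → ℝ) :
    Prop where
  eqn : ∀ l < N, ∀ p ∈ Set.Icc (1 : ℤ) M, schemeLHS μ lam τ h v z u w l p = 0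
  compact : ∀ l ≤ N, CompactRelation M h (u l) (w l)
  periodic_u : ∀ l ≤ N, IsPeriodicGrid M (u l)
  periodic_w : ∀ l ≤ N, IsPeriodicGrid M (w l)
  initial : ∀ p ∈ Set.Icc (1 : ℤ) M, u 0 p = φ (a + p * h)

/-- Step I: the nonlinear scheme on the coarse time grid. -/
def StepI (μ lam L T a : ℝ) (φ : ℝ → ℝ) (M Nc : ℕ) (uc wc : ℕ → ℤ → ℝ) : Prop :=
  SolvesScheme μ lam a (T / Nc) (L / M) M Nc φ uc wc uc wc

/-- Step II: `uf` is the linear interpolation in time of `uc` to the fine time grid with `β * Nc`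
steps (the values `r = 0` and `r = β` give `uf = uc` at the coarse time nodes), and `wf` is
obtained from `uf` by the compact relation. -/
structure StepII (L : ℝ) (M Nc β : ℕ) (uc uf wf : ℕ → ℤ → ℝ) : Prop where
  interp : ∀ q < Nc, ∀ r ≤ β, ∀ p ∈ Set.Icc (1 : ℤ) M,
    uf (q * β + r) p = (1 - (r : ℝ) / β) * uc q p + (r : ℝ) / β * uc (q + 1) p
  compact : ∀ k ≤ β * Nc, CompactRelation M (L / M) (uf k) (wf k)
  periodic_u : ∀ k ≤ β * Nc, IsPeriodicGrid M (uf k)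
  periodic_w : ∀ k ≤ β * Nc, IsPeriodicGrid M (wf k)

/-- Step III: the scheme on the fine time grid, linearized at the rough solution `(uf, wf)`. -/
def StepIII (μ lam L T a : ℝ) (φ : ℝ → ℝ) (M Nc β : ℕ) (uf wf u w : ℕ → ℤ → ℝ) : Prop :=
  SolvesScheme μ lam a (T / (β * Nc : ℕ)) (L / M) M (β * Nc) φ uf wf u w

/-! ### The constants -/

/-- `C₀`: the maximum of `|u|, |u_x|, |u_xx|, |u_xxx|` over `ℝ × [0, T]`. -/
def constC0 (T : ℝ) (u : ℝ → ℝ → ℝ) : ℝ :=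
  sSup {r : ℝ | ∃ j ≤ 3, ∃ x : ℝ, ∃ t ∈ Set.Icc (0 : ℝ) T, r = |dx j u x t|}

/-- `C₃`, as a function of `L`, `μ`, `lam`, `C₀` and the bound `Ct` for the rough solution. -/
def constC3 (L μ lam C0 Ct : ℝ) : ℝ :=
  max (10 * C0 ^ 2 / (9 * lam) + 5 * C0 ^ 2 * L ^ 2 / (108 * lam) + 20 * Ct ^ 2 / (9 * lam)
      + 5 * Ct ^ 2 * L ^ 2 / (27 * μ * lam) + 1 / lam)
    (3 / lam)

/-- The constant `Ct` bounds the errors of the rough fine-grid solution: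
`‖U^k - uf^k‖_∞ ≤ Ct` and `‖W^k - wf^k‖_∞ ≤ 6 Ct / h²` for all `0 ≤ k ≤ β Nc`, where
`U` and `W` are the grid values of the exact solution `u` and of `u_xx`. -/
def RoughErrorBound (L T a : ℝ) (u : ℝ → ℝ → ℝ) (M Nc β : ℕ) (uf wf : ℕ → ℤ → ℝ) (Ct : ℝ) :
    Prop :=
  ∀ k ≤ β * Nc,
    normMax M (restrict a (L / M) (T / (β * Nc : ℕ)) u k - uf k) ≤ Ct ∧
    normMax M (restrict a (L / M) (T / (β * Nc : ℕ)) (dx 2 u) k - wf k) ≤ 6 / (L / M) ^ 2 * Ct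

end BBMB

end

noncomputable section

namespace BBMB

open scoped ContDiff

/-! ### Sums over one period -/

/-! The proof is an energy argument. Let `A = 1 + (h²/12) δ_xx`. This operator is diagonally
dominant, hence invertible on periodic grid functions, and the compact relation says exactly that `v
= A g` and `w = δ_xx g` for one periodic `g` (`CompactPair`). All operators involved commute with
translations and are symmetric or skew, so summation by parts shows that `‖v‖² - μ⟨w,v⟩` dominates
`‖v‖² + μ|v|₁²`.

For any fixed first argument, `Ψ` is skew in its second one (`sum_psi_mul_self`). Testing the scheme
with the time average therefore removes the convection terms, and the energy does not increase, for
either scheme and any time step. With a discrete Sobolev inequality this bounds the coarse solution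
in maximum norm. Convex interpolation and the maximum principle for `A` carry the bound to `u_f` and
`w_f`, which gives (i).

For (ii), the exact grid function `U` is paired with its own compact second difference rather than
with the values of `u_xx`, so that errors are again compact pairs. By bilinearity the error solves
the scheme with the same first argument `(v, z)`, driven by the truncation error and by `Ψ(ε,U)` and
`h² Ψ(ζ,U)`, where `(ε, ζ)` is the error of `(v, z)`. In these terms the differences are moved onto
`U` and the test function, and `h²‖ζ‖ ≤ 6‖ε‖`; only derivatives of the exact solution and `‖ε‖`
enter (`energy_error_succ_le`), and no size bound on `(v, z)` is required.

In Step I, `ε` is the error itself and is absorbed into the growth rate of a Gronwall inequality. In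
Step III, `ε` is the interpolation error, of order `τ_c² + h⁴`, and acts as a source. Gronwall needs
`τK ≤ 1/2`; for larger `τ` the stability bound is already at most a constant times `τ⁴`. The
truncation error is of order `τ² + h⁴` by Taylor expansion at time midpoints and grid points. -/

theorem sum_Icc_int_eq_sum_range (M : ℕ) (f : ℤ → ℝ) :
    ∑ p ∈ Finset.Icc (1 : ℤ) M, f p = ∑ i ∈ Finset.range M, f (i + 1) := by
  induction M with
  | zero => simp
  | succ n ih =>
    rw [Finset.sum_range_succ, ← ih]
    have : Finset.Icc (1 : ℤ) ((n + 1 : ℕ) : ℤ) = insert ((n : ℤ) + 1) (Finset.Icc (1 : ℤ) n) := by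
      ext x; simp only [Finset.mem_Icc, Finset.mem_insert]; push_cast; omega
    rw [this, Finset.sum_insert (by simp), add_comm]

/-- All summations by parts below take this form: a periodic flux `a` is exhibited whose backward
difference is the summand. -/
theorem sum_eq_zero_of_telescope {M : ℕ} {f a : ℤ → ℝ} (ha : IsPeriodicGrid M a)
    (hf : ∀ p, f p = a p - a (p - 1)) : ∑ p ∈ Finset.Icc (1 : ℤ) M, f p = 0 := by
  rw [sum_Icc_int_eq_sum_range]
  have h := Finset.sum_range_sub (fun i : ℕ => a i) M
  have h0 := ha 0
  simp only [zero_add] at h0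
  simp only [Nat.cast_add, Nat.cast_one, Nat.cast_zero, h0, sub_self] at h
  rw [← h]
  refine Finset.sum_congr rfl fun i _ => ?_
  rw [hf]; simp

theorem IsPeriodicGrid.shift {M : ℕ} {v : ℤ → ℝ} (hv : IsPeriodicGrid M v) (k : ℤ) :
    IsPeriodicGrid M fun p => v (p + k) := fun p => by
  show v (p + M + k) = v (p + k)
  rw [show p + (M : ℤ) + k = p + k + M by ring]; exact hv _

theorem IsPeriodicGrid.comp₂ {M : ℕ} {v w : ℤ → ℝ} (hv : IsPeriodicGrid M v)
    (hw : IsPeriodicGrid M w) (F : ℝ → ℝ → ℝ) : IsPeriodicGrid M fun p => F (v p) (w p) :=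
  fun p => by simp only [hv p, hw p]

theorem sum_shift {M : ℕ} {f : ℤ → ℝ} (hf : IsPeriodicGrid M f) :
    ∑ p ∈ Finset.Icc (1 : ℤ) M, f (p + 1) = ∑ p ∈ Finset.Icc (1 : ℤ) M, f p := by
  rw [← sub_eq_zero, ← Finset.sum_sub_distrib]
  exact sum_eq_zero_of_telescope (a := fun p => f (p + 1)) (hf.shift 1) fun p => by simp

/-- Reduction of an index modulo the period. -/
theorem IsPeriodicGrid.exists_mem {M : ℕ} (hM : 0 < M) (p : ℤ) :
    ∃ q ∈ Set.Icc (1 : ℤ) M, ∀ v : ℤ → ℝ, IsPeriodicGrid M v → v p = v q := by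
  have hM' : (0 : ℤ) < M := by exact_mod_cast hM
  refine ⟨(p - 1) % M + 1, ⟨?_, ?_⟩, fun v hv => ?_⟩
  · have := Int.emod_nonneg (p - 1) hM'.ne'; omega
  · have := Int.emod_lt_of_pos (p - 1) hM'; omega
  · have hper : Function.Periodic v (M : ℤ) := hv
    have := hper.int_mul ((p - 1) / M) ((p - 1) % M + 1)
    rw [← this]
    congr 1
    have := Int.emod_add_mul_ediv (p - 1) M
    simp only [Int.cast_id]
    linarith

/-- The compact relation and the initial and interpolation conditions are imposed only for `1 ≤ p ≤
M`; periodicity extends them to all indices, where shifts can be used freely. -/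
theorem IsPeriodicGrid.forall_of_forall_mem {M : ℕ} (hM : 0 < M) {v w : ℤ → ℝ}
    (hv : IsPeriodicGrid M v) (hw : IsPeriodicGrid M w)
    (h : ∀ p ∈ Set.Icc (1 : ℤ) M, v p = w p) (p : ℤ) : v p = w p := by
  obtain ⟨q, hq, hp⟩ := IsPeriodicGrid.exists_mem hM p
  rw [hp v hv, hp w hw, h q hq]

/-! ### Difference operators -/

theorem deltaXX_eq (h : ℝ) (v : ℤ → ℝ) (p : ℤ) :
    deltaXX h v p = (v (p + 1) - 2 * v p + v (p - 1)) / h ^ 2 := by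
  unfold deltaXX deltaHalf
  rw [show p + 1 - 1 = p by ring, ← sub_div, div_div]
  congr 1 <;> ring

theorem IsPeriodicGrid.deltaXX {M : ℕ} {v : ℤ → ℝ} (hv : IsPeriodicGrid M v) (h : ℝ) :
    IsPeriodicGrid M (deltaXX h v) := fun p => by
  have h1 := hv.shift 1 p
  have h2 := hv.shift (-1) p
  simp only [← sub_eq_add_neg] at h1 h2
  rw [deltaXX_eq, deltaXX_eq, h1, h2, hv]

theorem IsPeriodicGrid.deltaHalf {M : ℕ} {v : ℤ → ℝ} (hv : IsPeriodicGrid M v) (h : ℝ) :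
    IsPeriodicGrid M (deltaHalf h v) := fun p => by
  have h2 := hv.shift (-1) p
  simp only [← sub_eq_add_neg] at h2
  unfold BBMB.deltaHalf
  rw [h2, hv]

theorem IsPeriodicGrid.add {M : ℕ} {v w : ℤ → ℝ} (hv : IsPeriodicGrid M v)
    (hw : IsPeriodicGrid M w) : IsPeriodicGrid M (v + w) := fun p => by
  simp only [Pi.add_apply, hv p, hw p]

theorem IsPeriodicGrid.sub {M : ℕ} {v w : ℤ → ℝ} (hv : IsPeriodicGrid M v)
    (hw : IsPeriodicGrid M w) : IsPeriodicGrid M (v - w) := fun p => by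
  simp only [Pi.sub_apply, hv p, hw p]

theorem IsPeriodicGrid.smul {M : ℕ} {v : ℤ → ℝ} (hv : IsPeriodicGrid M v) (c : ℝ) :
    IsPeriodicGrid M (c • v) := fun p => by
  simp only [Pi.smul_apply, hv p]

/-- The compact averaging operator `1 + (h²/12) δ_xx`. -/
def compactOp (h : ℝ) (v : ℤ → ℝ) (p : ℤ) : ℝ := v p + h ^ 2 / 12 * deltaXX h v p

theorem compactOp_eq {h : ℝ} (hh : 0 < h) (v : ℤ → ℝ) (p : ℤ) :
    compactOp h v p = 5 / 6 * v p + (v (p + 1) + v (p - 1)) / 12 := by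
  unfold compactOp
  rw [deltaXX_eq]
  field_simp
  ring

/-- Maximum principle for the compact averaging operator. -/
theorem abs_le_of_abs_compactOp_le {M : ℕ} (hM : 0 < M) {h c : ℝ} (hh : 0 < h) {v : ℤ → ℝ}
    (hv : IsPeriodicGrid M v) (hc : ∀ p, |compactOp h v p| ≤ c) (p : ℤ) :
    |v p| ≤ 3 / 2 * c := by
  obtain ⟨q, hq, hmax⟩ := Finset.exists_max_image (Finset.Icc (1 : ℤ) M) (fun p => |v p|)
    ⟨1, by simp only [Finset.mem_Icc]; omega⟩
  have hall : ∀ p, |v p| ≤ |v q| := fun p => by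
    obtain ⟨r, hr, hp⟩ := IsPeriodicGrid.exists_mem hM p
    rw [hp v hv]
    exact hmax r (by simpa using hr)
  have h1 := hc q
  -- At a maximum point of `|v|` the neighbours cost at most `1/6` of the maximum against the
  -- diagonal weight `5/6`; the remaining `2/3` gives the factor `3/2`.
  rw [compactOp_eq hh] at h1
  have h2 := abs_le.1 (hall (q + 1))
  have h3 := abs_le.1 (hall (q - 1))
  have h4 := abs_le.1 h1
  refine (hall p).trans ?_
  rcases abs_cases (v q) with h5 | h5 <;> linarith [h2.1, h2.2, h3.1, h3.2, h4.1, h4.2, h5.1]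

/-- On functions on `ZMod M` the operator is an endomorphism of a finite-dimensional space. The
maximum principle with bound `0` makes it injective, hence surjective. -/
theorem exists_compactOp_eq {M : ℕ} (hM : 0 < M) {h : ℝ} (hh : 0 < h) {v : ℤ → ℝ}
    (hv : IsPeriodicGrid M v) :
    ∃ g, IsPeriodicGrid M g ∧ ∀ p, compactOp h g p = v p := by
  have : NeZero M := ⟨hM.ne'⟩
  let A : (ZMod M → ℝ) →ₗ[ℝ] (ZMod M → ℝ) :=
    { toFun := fun g i => 5 / 6 * g i + (g (i + 1) + g (i - 1)) / 12
      map_add' := fun f g => by ext i; simp only [Pi.add_apply]; ring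
      map_smul' := fun c g => by
        ext i; simp only [Pi.smul_apply, smul_eq_mul, RingHom.id_apply]; ring }
  have hper : ∀ g : ZMod M → ℝ, IsPeriodicGrid M fun p : ℤ => g (p : ZMod M) := fun g p => by simp
  have hA : ∀ (g : ZMod M → ℝ) (p : ℤ),
      compactOp h (fun p : ℤ => g (p : ZMod M)) p = A g (p : ZMod M) := fun g p => by
    rw [compactOp_eq hh]; simp [A]
  have hinj : Function.Injective A := by
    rw [← LinearMap.ker_eq_bot, LinearMap.ker_eq_bot']
    intro g hg
    ext i
    obtain ⟨p, rfl⟩ := ZMod.intCast_surjective i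
    have := abs_le_of_abs_compactOp_le hM hh (hper g) (c := 0)
      (fun p => by rw [hA, hg]; simp) p
    simpa using this
  obtain ⟨g, hg⟩ := (LinearMap.injective_iff_surjective.1 hinj) fun i => v (i.val : ℤ)
  refine ⟨_, hper g, fun p => ?_⟩
  rw [hA, hg]
  simp only [ZMod.val_intCast]
  have hp : Function.Periodic v (M : ℤ) := hv
  have := hp.int_mul (p / M) (p % M)
  rw [← this]
  congr 1
  have := Int.emod_add_mul_ediv p M
  simp only [Int.cast_id]
  linarith

theorem sum_deltaHalf_mul {M : ℕ} {h : ℝ} {v w : ℤ → ℝ} (hv : IsPeriodicGrid M v)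
    (hw : IsPeriodicGrid M w) :
    ∑ p ∈ Finset.Icc (1 : ℤ) M, deltaHalf h v p * deltaHalf h w p
      = -∑ p ∈ Finset.Icc (1 : ℤ) M, deltaXX h v p * w p := by
  rw [← sub_eq_zero, sub_neg_eq_add, ← Finset.sum_add_distrib]
  refine sum_eq_zero_of_telescope (a := fun p => deltaHalf h v (p + 1) * w p / h)
    (fun p => ?_) fun p => ?_
  · have h1 := (hv.deltaHalf h).shift 1 p
    simp only at h1
    simp only [h1, hw p]
  · rw [show p - 1 + 1 = p by ring]
    simp only [deltaXX]
    rw [show deltaHalf h w p = (w p - w (p - 1)) / h from rfl]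
    ring

theorem deltaHalf_sq_le {h : ℝ} (v : ℤ → ℝ) (p : ℤ) :
    deltaHalf h v p ^ 2 ≤ 2 * (v p ^ 2 + v (p - 1) ^ 2) / h ^ 2 := by
  rw [deltaHalf, div_pow]
  gcongr
  nlinarith [sq_nonneg (v p + v (p - 1))]

theorem sum_shift_neg {M : ℕ} {f : ℤ → ℝ} (hf : IsPeriodicGrid M f) :
    ∑ p ∈ Finset.Icc (1 : ℤ) M, f (p - 1) = ∑ p ∈ Finset.Icc (1 : ℤ) M, f p := by
  have := sum_shift (hf.shift (-1))
  simp only [← sub_eq_add_neg, add_sub_cancel_right] at this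
  exact this.symm

theorem sum_deltaHalf_sq_le {M : ℕ} {h : ℝ} {v : ℤ → ℝ} (hv : IsPeriodicGrid M v) :
    ∑ p ∈ Finset.Icc (1 : ℤ) M, deltaHalf h v p ^ 2
      ≤ 4 / h ^ 2 * ∑ p ∈ Finset.Icc (1 : ℤ) M, v p ^ 2 := by
  have hs := sum_shift_neg (M := M) (f := fun p => v p ^ 2) (fun p => by simp only [hv p])
  calc _ ≤ ∑ p ∈ Finset.Icc (1 : ℤ) M, 2 * (v p ^ 2 + v (p - 1) ^ 2) / h ^ 2 :=
        Finset.sum_le_sum fun p _ => deltaHalf_sq_le v p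
    _ = _ := by
        rw [← Finset.sum_div, ← Finset.mul_sum, Finset.sum_add_distrib, hs]; ring

theorem deltaXX_sq_le {h : ℝ} (v : ℤ → ℝ) (p : ℤ) :
    deltaXX h v p ^ 2 ≤ 4 * (v (p + 1) ^ 2 + 2 * v p ^ 2 + v (p - 1) ^ 2) / h ^ 4 := by
  rw [deltaXX_eq, div_pow, show (h ^ 2) ^ 2 = h ^ 4 by ring]
  gcongr ?_ / _
  nlinarith [sq_nonneg (v (p + 1) + v p), sq_nonneg (v p + v (p - 1)),
    sq_nonneg (v (p + 1) - v (p - 1))]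

theorem sum_deltaXX_sq_le {M : ℕ} {h : ℝ} {v : ℤ → ℝ} (hv : IsPeriodicGrid M v) :
    ∑ p ∈ Finset.Icc (1 : ℤ) M, deltaXX h v p ^ 2
      ≤ 16 / h ^ 4 * ∑ p ∈ Finset.Icc (1 : ℤ) M, v p ^ 2 := by
  have hs := sum_shift_neg (M := M) (f := fun p => v p ^ 2) (fun p => by simp only [hv p])
  have hs' := sum_shift (M := M) (f := fun p => v p ^ 2) (fun p => by simp only [hv p])
  calc _ ≤ ∑ p ∈ Finset.Icc (1 : ℤ) M,
          4 * (v (p + 1) ^ 2 + 2 * v p ^ 2 + v (p - 1) ^ 2) / h ^ 4 :=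
        Finset.sum_le_sum fun p _ => deltaXX_sq_le v p
    _ = _ := by
        rw [← Finset.sum_div, ← Finset.mul_sum, Finset.sum_add_distrib, Finset.sum_add_distrib,
          hs, hs', ← Finset.mul_sum]; ring

theorem sum_centralDiff_sq_le {M : ℕ} {h : ℝ} {v : ℤ → ℝ} (hv : IsPeriodicGrid M v) :
    ∑ p ∈ Finset.Icc (1 : ℤ) M, centralDiff h v p ^ 2
      ≤ ∑ p ∈ Finset.Icc (1 : ℤ) M, deltaHalf h v p ^ 2 := by
  have hs := sum_shift (M := M) (f := fun p => deltaHalf h v p ^ 2)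
    (fun p => by simp only [hv.deltaHalf h p])
  calc _ ≤ ∑ p ∈ Finset.Icc (1 : ℤ) M, (deltaHalf h v (p + 1) ^ 2 + deltaHalf h v p ^ 2) / 2 :=
        Finset.sum_le_sum fun p _ => by
          have e : centralDiff h v p = (deltaHalf h v (p + 1) + deltaHalf h v p) / 2 := by
            simp only [centralDiff, deltaHalf]
            rw [show p + 1 - 1 = p by ring]; ring
          rw [e]
          nlinarith [sq_nonneg (deltaHalf h v (p + 1) - deltaHalf h v p)]
    _ = _ := by
        rw [← Finset.sum_div, Finset.sum_add_distrib, hs]; ring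

theorem sum_centralDiff_mul {M : ℕ} {h : ℝ} {v w : ℤ → ℝ} (hv : IsPeriodicGrid M v)
    (hw : IsPeriodicGrid M w) :
    ∑ p ∈ Finset.Icc (1 : ℤ) M, centralDiff h v p * w p
      = -∑ p ∈ Finset.Icc (1 : ℤ) M, v p * centralDiff h w p := by
  rw [← sub_eq_zero, sub_neg_eq_add, ← Finset.sum_add_distrib]
  refine sum_eq_zero_of_telescope
    (a := fun p => (v (p + 1) * w p + v p * w (p + 1)) / (2 * h)) (fun p => ?_) fun p => ?_
  · have h1 := hv.shift 1 p
    have h2 := hw.shift 1 p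
    simp only at h1 h2
    simp only [h1, h2, hw p, hv p]
  · rw [show p - 1 + 1 = p by ring]
    simp only [centralDiff]
    ring

/-- Summation by parts turns the conservative half `Δ_x(vw)` of `Ψ` into minus the advective half `v
Δ_x w`, so the two cancel when tested with `w`, for every `v`. This is the source of unconditional
stability. -/
theorem sum_psi_mul_self {M : ℕ} {h : ℝ} {v w : ℤ → ℝ} (hv : IsPeriodicGrid M v)
    (hw : IsPeriodicGrid M w) : ∑ p ∈ Finset.Icc (1 : ℤ) M, psi h v w p * w p = 0 := by
  have := sum_centralDiff_mul (h := h) (v := fun q => v q * w q) (w := w)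
    (hv.comp₂ hw fun a b => a * b) hw
  simp only [psi, div_mul_eq_mul_div, add_mul]
  rw [← Finset.sum_div, Finset.sum_add_distrib, this, ← sub_eq_add_neg, ← Finset.sum_sub_distrib]
  rw [Finset.sum_eq_zero fun p _ => by ring, zero_div]

/-! ### Compact pairs -/

/-- `w` is the compact second difference of `v`: both are obtained from a periodic `g` by
`v = (1 + (h²/12) δ_xx) g` and `w = δ_xx g`. -/
def CompactPair (M : ℕ) (h : ℝ) (v w : ℤ → ℝ) : Prop :=
  ∃ g, IsPeriodicGrid M g ∧ (∀ p, v p = compactOp h g p) ∧ ∀ p, w p = deltaXX h g p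

theorem exists_compactPair {M : ℕ} (hM : 0 < M) {h : ℝ} (hh : 0 < h) {v : ℤ → ℝ}
    (hv : IsPeriodicGrid M v) : ∃ w, CompactPair M h v w := by
  obtain ⟨g, hg, hgv⟩ := exists_compactOp_eq hM hh hv
  exact ⟨_, g, hg, fun p => (hgv p).symm, fun p => rfl⟩

namespace CompactPair

variable {M : ℕ} {h : ℝ} {v w v' w' : ℤ → ℝ}

theorem compactOp_right (H : CompactPair M h v w) (p : ℤ) : compactOp h w p = deltaXX h v p := by
  obtain ⟨g, hg, hv, hw⟩ := H
  simp only [compactOp, deltaXX_eq, hv, hw]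
  ring

theorem periodic_left (H : CompactPair M h v w) : IsPeriodicGrid M v := by
  obtain ⟨g, hg, hv, hw⟩ := H
  intro p
  rw [hv, hv, compactOp, compactOp, hg, hg.deltaXX h]

theorem periodic_right (H : CompactPair M h v w) : IsPeriodicGrid M w := by
  obtain ⟨g, hg, hv, hw⟩ := H
  intro p
  rw [hw, hw, hg.deltaXX h]

/-- The difference of two candidates lies in the kernel of the averaging operator, which is trivial
by the maximum principle. -/
theorem unique (hM : 0 < M) (hh : 0 < h) (H : CompactPair M h v w) (hw' : IsPeriodicGrid M w')
    (h' : ∀ p, compactOp h w' p = deltaXX h v p) (p : ℤ) : w' p = w p := by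
  have := abs_le_of_abs_compactOp_le hM hh (hw'.sub H.periodic_right) (c := 0) (fun p => by
    have e : compactOp h (w' - w) p = compactOp h w' p - compactOp h w p := by
      simp only [compactOp, deltaXX_eq, Pi.sub_apply]; ring
    rw [e, h', H.compactOp_right]; simp) p
  simp only [Pi.sub_apply, mul_zero, abs_nonpos_iff] at this
  linarith

/-- Produces the common potential `g` from the implicit relation: a compact pair for `v` exists, and
its second component must be `w` by uniqueness. -/
theorem of_compactRelation (hM : 0 < M) (hh : 0 < h) (hv : IsPeriodicGrid M v)
    (hw : IsPeriodicGrid M w) (H : CompactRelation M h v w) : CompactPair M h v w := by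
  obtain ⟨w', h'⟩ := exists_compactPair hM hh hv
  have e : ∀ p, w p = w' p := h'.unique hM hh hw fun p => by
    have := IsPeriodicGrid.forall_of_forall_mem hM hw
      ((hv.deltaXX h).sub ((hw.deltaXX h).smul (h ^ 2 / 12))) (fun p hp => H p hp) p
    simp only [Pi.sub_apply, Pi.smul_apply, smul_eq_mul] at this
    rw [compactOp]; linarith
  rwa [show w = w' from funext e]

theorem add (H : CompactPair M h v w) (H' : CompactPair M h v' w') :
    CompactPair M h (v + v') (w + w') := by
  obtain ⟨g, hg, hv, hw⟩ := H
  obtain ⟨g', hg', hv', hw'⟩ := H'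
  refine ⟨g + g', hg.add hg', fun p => ?_, fun p => ?_⟩ <;>
    simp only [Pi.add_apply, hv, hv', hw, hw', compactOp, deltaXX_eq] <;> ring

theorem smul (c : ℝ) (H : CompactPair M h v w) : CompactPair M h (c • v) (c • w) := by
  obtain ⟨g, hg, hv, hw⟩ := H
  refine ⟨c • g, hg.smul c, fun p => ?_, fun p => ?_⟩ <;>
    simp only [Pi.smul_apply, smul_eq_mul, hv, hw, compactOp, deltaXX_eq] <;> ring

theorem sub (H : CompactPair M h v w) (H' : CompactPair M h v' w') :
    CompactPair M h (v - v') (w - w') := by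
  have := H.add (H'.smul (-1))
  simpa [sub_eq_add_neg] using this

/-- The pairing is that of `Δ_x δ_xx g` with `A g`. The operators commute, `δ_xx` and `A` are
symmetric and `Δ_x` is skew, so the form vanishes; the proof gives the flux explicitly. -/
theorem sum_centralDiff_mul (H : CompactPair M h v w) :
    ∑ p ∈ Finset.Icc (1 : ℤ) M, centralDiff h w p * v p = 0 := by
  obtain ⟨g, hg, hv, hw⟩ := H
  have hG := hg.deltaXX h
  refine sum_eq_zero_of_telescope
    (a := fun p => (h ^ 2 / 12 * (deltaXX h g (p + 1) * deltaXX h g p)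
      + (g (p + 2) * g p + g (p + 1) * g (p - 1) - 2 * (g (p + 1) * g p)) / h ^ 2) / (2 * h))
    (fun p => ?_) fun p => ?_
  · have h1 := hG.shift 1 p
    have h2 := hg.shift 1 p
    have h3 := hg.shift 2 p
    have h4 := hg.shift (-1) p
    simp only [← sub_eq_add_neg] at h1 h2 h3 h4
    simp only [h1, h2, h3, h4, hG p, hg p]
  · simp only [centralDiff, hv, hw, compactOp]
    have e1 : deltaXX h g (p + 1) - deltaXX h g (p - 1)
        = (g (p + 2) - 2 * g (p + 1) + 2 * g (p - 1) - g (p - 2)) / h ^ 2 := by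
      rw [deltaXX_eq, deltaXX_eq]; ring_nf
    have e2 : p - 1 + 1 = p := by ring
    have e3 : p - 1 + 2 = p + 1 := by ring
    have e4 : p - 1 - 1 = p - 2 := by ring
    rw [e2, e3, e4]
    linear_combination (g p / (2 * h)) * e1

/-- Symmetry of the form, inherited from `δ_xx` and `A`; the flux is the discrete Wronskian of the
two potentials. -/
theorem sum_mul_comm (H : CompactPair M h v w) (H' : CompactPair M h v' w') :
    ∑ p ∈ Finset.Icc (1 : ℤ) M, w p * v' p = ∑ p ∈ Finset.Icc (1 : ℤ) M, w' p * v p := by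
  obtain ⟨g, hg, hv, hw⟩ := H
  obtain ⟨g', hg', hv', hw'⟩ := H'
  rw [← sub_eq_zero, ← Finset.sum_sub_distrib]
  refine sum_eq_zero_of_telescope
    (a := fun p => (g (p + 1) * g' p - g p * g' (p + 1)) / h ^ 2)
    (fun p => ?_) fun p => ?_
  · have h1 := hg.shift 1 p
    have h2 := hg'.shift 1 p
    simp only at h1 h2
    simp only [h1, h2, hg p, hg' p]
  · simp only [hv, hv', hw, hw', compactOp]
    rw [deltaXX_eq, deltaXX_eq, show p - 1 + 1 = p by ring]
    ring

/-- In terms of the potential `g`, up to the factor `h`, the right side is `|g|₁² - (h²/12)‖δ_xx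
g‖²`. The left side is at most `|g|₁² - (h²/6 - h²/36)‖δ_xx g‖²`, by the inverse inequality `|G|₁² ≤
(4/h²)‖G‖²`, and `1/6 - 1/36 ≥ 1/12`. -/
theorem sum_deltaHalf_sq_le (hh : 0 < h) (H : CompactPair M h v w) :
    ∑ p ∈ Finset.Icc (1 : ℤ) M, deltaHalf h v p ^ 2
      ≤ -∑ p ∈ Finset.Icc (1 : ℤ) M, w p * v p := by
  obtain ⟨g, hg, hv, hw⟩ := H
  have hG := hg.deltaXX h
  have h1 := sum_deltaHalf_mul (h := h) hg hg
  have h2 := sum_deltaHalf_mul (h := h) hg hG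
  have h3 := BBMB.sum_deltaHalf_sq_le (h := h) hG
  have e1 : ∑ p ∈ Finset.Icc (1 : ℤ) M, deltaHalf h v p ^ 2
      = ∑ p ∈ Finset.Icc (1 : ℤ) M, deltaHalf h g p * deltaHalf h g p
        + h ^ 2 / 6 * ∑ p ∈ Finset.Icc (1 : ℤ) M, deltaHalf h g p * deltaHalf h (deltaXX h g) p
        + h ^ 4 / 144 * ∑ p ∈ Finset.Icc (1 : ℤ) M, deltaHalf h (deltaXX h g) p ^ 2 := by
    rw [Finset.mul_sum, Finset.mul_sum, ← Finset.sum_add_distrib, ← Finset.sum_add_distrib]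
    refine Finset.sum_congr rfl fun p _ => ?_
    have : deltaHalf h v p = deltaHalf h g p + h ^ 2 / 12 * deltaHalf h (deltaXX h g) p := by
      simp only [deltaHalf, hv, compactOp]; ring
    rw [this]; ring
  have e2 : ∑ p ∈ Finset.Icc (1 : ℤ) M, w p * v p
      = ∑ p ∈ Finset.Icc (1 : ℤ) M, deltaXX h g p * g p
        + h ^ 2 / 12 * ∑ p ∈ Finset.Icc (1 : ℤ) M, deltaXX h g p * deltaXX h g p := by
    rw [Finset.mul_sum, ← Finset.sum_add_distrib]
    refine Finset.sum_congr rfl fun p _ => ?_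
    simp only [hv, hw, compactOp]; ring
  simp only [← pow_two] at h2 e2
  have h4 : h ^ 4 / 144 * ∑ p ∈ Finset.Icc (1 : ℤ) M, deltaHalf h (deltaXX h g) p ^ 2
      ≤ h ^ 2 / 36 * ∑ p ∈ Finset.Icc (1 : ℤ) M, deltaXX h g p ^ 2 := by
    calc _ ≤ h ^ 4 / 144 * (4 / h ^ 2 * ∑ p ∈ Finset.Icc (1 : ℤ) M, deltaXX h g p ^ 2) := by
          gcongr
      _ = _ := by field_simp; ring
  have h5 : 0 ≤ h ^ 2 * ∑ p ∈ Finset.Icc (1 : ℤ) M, deltaXX h g p ^ 2 := by positivity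
  rw [e1, e2, h1, h2]
  linarith

/-- Test `A w = δ_xx v` with `w`. The inverse inequality gives `⟨A w, w⟩ ≥ (2/3)‖w‖²`, Young's
inequality then yields `‖w‖² ≤ (9/4)‖δ_xx v‖²`, and `‖δ_xx v‖² ≤ (16/h⁴)‖v‖²`. This is what makes
the factor `h²` in front of `Ψ(w, ·)` sufficient. -/
theorem sum_sq_right_le (hh : 0 < h) (H : CompactPair M h v w) :
    h ^ 4 * ∑ p ∈ Finset.Icc (1 : ℤ) M, w p ^ 2 ≤ 36 * ∑ p ∈ Finset.Icc (1 : ℤ) M, v p ^ 2 := by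
  have h1 := sum_deltaHalf_mul (h := h) H.periodic_right H.periodic_right
  have h2 := BBMB.sum_deltaHalf_sq_le (h := h) H.periodic_right
  have h3 := sum_deltaXX_sq_le (h := h) H.periodic_left
  have h4 : ∑ p ∈ Finset.Icc (1 : ℤ) M, w p ^ 2
      + h ^ 2 / 12 * ∑ p ∈ Finset.Icc (1 : ℤ) M, deltaXX h w p * w p
      ≤ 1 / 3 * ∑ p ∈ Finset.Icc (1 : ℤ) M, w p ^ 2
        + 3 / 4 * ∑ p ∈ Finset.Icc (1 : ℤ) M, deltaXX h v p ^ 2 := by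
    rw [Finset.mul_sum, Finset.mul_sum, Finset.mul_sum, ← Finset.sum_add_distrib,
      ← Finset.sum_add_distrib]
    refine Finset.sum_le_sum fun p _ => ?_
    have := H.compactOp_right p
    rw [compactOp] at this
    have e : w p ^ 2 + h ^ 2 / 12 * (deltaXX h w p * w p) = deltaXX h v p * w p := by
      rw [← this]; ring
    rw [e]
    nlinarith [sq_nonneg (2 * w p - 3 * deltaXX h v p)]
  simp only [← pow_two] at h1
  have h5 : h ^ 2 * (4 / h ^ 2 * ∑ p ∈ Finset.Icc (1 : ℤ) M, w p ^ 2)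
      = 4 * ∑ p ∈ Finset.Icc (1 : ℤ) M, w p ^ 2 := by field_simp
  have h6 : h ^ 4 * (16 / h ^ 4 * ∑ p ∈ Finset.Icc (1 : ℤ) M, v p ^ 2)
      = 16 * ∑ p ∈ Finset.Icc (1 : ℤ) M, v p ^ 2 := by field_simp
  have h7 := mul_le_mul_of_nonneg_left h2 (by positivity : 0 ≤ h ^ 2)
  have h8 := mul_le_mul_of_nonneg_left h3 (by positivity : 0 ≤ h ^ 4)
  rw [h5, h1] at h7
  rw [h6] at h8
  have h9 : ∑ p ∈ Finset.Icc (1 : ℤ) M, w p ^ 2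
      ≤ 9 / 4 * ∑ p ∈ Finset.Icc (1 : ℤ) M, deltaXX h v p ^ 2 := by linarith
  have h10 := mul_le_mul_of_nonneg_left h9 (by positivity : 0 ≤ h ^ 4)
  linarith

end CompactPair

/-! ### Discrete Sobolev inequality -/

theorem abs_sub_le_sum_abs {M : ℕ} (v : ℤ → ℝ) {p q : ℤ} (hp : 1 ≤ p) (hpq : p ≤ q) (hq : q ≤ M) :
    |v q - v p| ≤ ∑ i ∈ Finset.Icc (1 : ℤ) M, |v i - v (i - 1)| := by
  obtain ⟨n, rfl⟩ := Int.le.dest hpq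
  have key : ∀ n : ℕ, |v (p + n) - v p| ≤ ∑ i ∈ Finset.Icc (p + 1) (p + n), |v i - v (i - 1)| := by
    intro n
    induction n with
    | zero => simp
    | succ n ih =>
      have : Finset.Icc (p + 1) (p + ((n + 1 : ℕ) : ℤ))
          = insert (p + n + 1) (Finset.Icc (p + 1) (p + n)) := by
        ext x; simp only [Finset.mem_Icc, Finset.mem_insert]; push_cast; omega
      rw [this, Finset.sum_insert (by simp)]
      have e : v (p + ((n + 1 : ℕ) : ℤ)) = v (p + n + 1) := by push_cast; ring_nf
      rw [e, show p + (n : ℤ) + 1 - 1 = p + n by ring]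
      calc |v (p + n + 1) - v p| = |(v (p + n + 1) - v (p + n)) + (v (p + n) - v p)| := by ring_nf
        _ ≤ _ := (abs_add_le _ _).trans (by gcongr)
  refine (key n).trans (Finset.sum_le_sum_of_subset_of_nonneg ?_ fun _ _ _ => abs_nonneg _)
  intro x; simp only [Finset.mem_Icc]; omega

/-- Compare `v p` with every `v q` of the period: they differ by at most the total variation `D`,
and Cauchy-Schwarz bounds `D²` by the seminorm. Summing over `q` produces the `L²` term, needed
because no zero mean is assumed. -/
theorem sq_le_of_mem {M : ℕ} {h : ℝ} (hh : 0 < h) (v : ℤ → ℝ) {p : ℤ}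
    (hp : p ∈ Set.Icc (1 : ℤ) M) :
    M * h * v p ^ 2 ≤ 2 * (h * ∑ q ∈ Finset.Icc (1 : ℤ) M, v q ^ 2)
      + 2 * (M * h) ^ 2 * (h * ∑ q ∈ Finset.Icc (1 : ℤ) M, deltaHalf h v q ^ 2) := by
  have hcard : (Finset.Icc (1 : ℤ) M).card = M := by simp
  set D := ∑ i ∈ Finset.Icc (1 : ℤ) M, |v i - v (i - 1)| with hD
  have h1 : ∀ q ∈ Finset.Icc (1 : ℤ) M, v p ^ 2 ≤ 2 * v q ^ 2 + 2 * D ^ 2 := by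
    intro q hq
    rw [Finset.mem_Icc] at hq
    have : |v p - v q| ≤ D := by
      rcases le_total q p with hqp | hqp
      · exact abs_sub_le_sum_abs v hq.1 hqp hp.2
      · rw [abs_sub_comm]; exact abs_sub_le_sum_abs v hp.1 hqp hq.2
    have h2 := sq_le_sq' (abs_le.1 this).1 (abs_le.1 this).2
    nlinarith [sq_nonneg (v p - 2 * v q)]
  have h2 := Finset.sum_le_sum h1
  rw [Finset.sum_const, hcard, Finset.sum_add_distrib, ← Finset.mul_sum, Finset.sum_const, hcard,
    nsmul_eq_mul, nsmul_eq_mul] at h2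
  have h3 : D ^ 2 ≤ M * ∑ q ∈ Finset.Icc (1 : ℤ) M, (v q - v (q - 1)) ^ 2 := by
    have := sq_sum_le_card_mul_sum_sq (s := Finset.Icc (1 : ℤ) M) (f := fun i => |v i - v (i - 1)|)
    simpa [hcard] using this
  have h4 : ∑ q ∈ Finset.Icc (1 : ℤ) M, (v q - v (q - 1)) ^ 2
      = h ^ 2 * ∑ q ∈ Finset.Icc (1 : ℤ) M, deltaHalf h v q ^ 2 := by
    rw [Finset.mul_sum]
    refine Finset.sum_congr rfl fun q _ => ?_
    rw [deltaHalf]; field_simp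
  rw [h4] at h3
  have h5 := mul_le_mul_of_nonneg_left h2 hh.le
  have h6 := mul_le_mul_of_nonneg_left h3 (by positivity : 0 ≤ h * M)
  nlinarith

/-! ### The discrete energy -/

/-- The discrete energy `‖v‖² - μ ⟨w, v⟩`. -/
def energy (μ : ℝ) (M : ℕ) (h : ℝ) (v w : ℤ → ℝ) : ℝ :=
  h * ∑ p ∈ Finset.Icc (1 : ℤ) M, (v p ^ 2 - μ * (w p * v p))

section Energy

variable {μ lam τ h : ℝ} {M : ℕ} {v w v' w' : ℤ → ℝ}

theorem CompactPair.le_energy (hμ : 0 ≤ μ) (hh : 0 < h) (H : CompactPair M h v w) :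
    h * ∑ p ∈ Finset.Icc (1 : ℤ) M, v p ^ 2
      + μ * (h * ∑ p ∈ Finset.Icc (1 : ℤ) M, deltaHalf h v p ^ 2) ≤ energy μ M h v w := by
  have h1 := mul_le_mul_of_nonneg_left (H.sum_deltaHalf_sq_le hh) (mul_nonneg hμ hh.le)
  rw [energy, Finset.sum_sub_distrib, ← Finset.mul_sum]
  linarith

theorem CompactPair.energy_nonneg (hμ : 0 ≤ μ) (hh : 0 < h) (H : CompactPair M h v w) :
    0 ≤ energy μ M h v w :=
  le_trans (by positivity) (H.le_energy hμ hh)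

/-- The parallelogram identity. Together with nonnegativity of the energy of the other combination
it replaces the triangle inequality for sums and differences of compact pairs. -/
theorem energy_add_add_energy_sub :
    energy μ M h (v + v') (w + w') + energy μ M h (v - v') (w - w')
      = 2 * energy μ M h v w + 2 * energy μ M h v' w' := by
  simp only [energy, Finset.mul_sum]
  rw [← Finset.sum_add_distrib, ← Finset.sum_add_distrib]
  refine Finset.sum_congr rfl fun p _ => ?_
  simp only [Pi.add_apply, Pi.sub_apply]
  ring

theorem energy_sub_le (hμ : 0 ≤ μ) (hh : 0 < h) (H : CompactPair M h v w)
    (H' : CompactPair M h v' w') :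
    energy μ M h (v - v') (w - w') ≤ 2 * energy μ M h v w + 2 * energy μ M h v' w' := by
  have := energy_add_add_energy_sub (μ := μ) (M := M) (h := h) (v := v) (v' := v') (w := w)
    (w' := w')
  linarith [(H.add H').energy_nonneg hμ hh]

theorem energy_add_le (hμ : 0 ≤ μ) (hh : 0 < h) (H : CompactPair M h v w)
    (H' : CompactPair M h v' w') :
    energy μ M h (v + v') (w + w') ≤ 2 * energy μ M h v w + 2 * energy μ M h v' w' := by
  have := energy_add_add_energy_sub (μ := μ) (M := M) (h := h) (v := v) (v' := v') (w := w)
    (w' := w')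
  linarith [(H.sub H').energy_nonneg hμ hh]

theorem energy_smul (c : ℝ) : energy μ M h (c • v) (c • w) = c ^ 2 * energy μ M h v w := by
  simp only [energy, Pi.smul_apply, smul_eq_mul, Finset.mul_sum]
  refine Finset.sum_congr rfl fun p _ => by ring

theorem timeAvg_eq (v : ℕ → ℤ → ℝ) (l : ℕ) : timeAvg v l = (1 / 2 : ℝ) • (v (l + 1) + v l) := by
  ext p; simp only [timeAvg, Pi.smul_apply, Pi.add_apply, smul_eq_mul]; ring

theorem IsPeriodicGrid.timeAvg {v : ℕ → ℤ → ℝ} {l : ℕ} (h0 : IsPeriodicGrid M (v l))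
    (h1 : IsPeriodicGrid M (v (l + 1))) : IsPeriodicGrid M (timeAvg v l) := by
  rw [timeAvg_eq]; exact (h1.add h0).smul _

theorem CompactPair.timeAvg {v w : ℕ → ℤ → ℝ} {l : ℕ} (h0 : CompactPair M h (v l) (w l))
    (h1 : CompactPair M h (v (l + 1)) (w (l + 1))) :
    CompactPair M h (timeAvg v l) (timeAvg w l) := by
  rw [timeAvg_eq, timeAvg_eq]; exact (h1.add h0).smul _

theorem energy_timeAvg_le {v w : ℕ → ℤ → ℝ} {l : ℕ} (hμ : 0 ≤ μ) (hh : 0 < h)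
    (h0 : CompactPair M h (v l) (w l)) (h1 : CompactPair M h (v (l + 1)) (w (l + 1))) :
    energy μ M h (timeAvg v l) (timeAvg w l)
      ≤ (energy μ M h (v (l + 1)) (w (l + 1)) + energy μ M h (v l) (w l)) / 2 := by
  rw [timeAvg_eq, timeAvg_eq, energy_smul]
  linarith [energy_add_le hμ hh h1 h0]

/-- The energy identity for one step of the scheme. -/
theorem sum_schemeLHS_mul_timeAvg (hτ : τ ≠ 0) {v z e r : ℕ → ℤ → ℝ} {l : ℕ}
    (hv : IsPeriodicGrid M (timeAvg v l)) (hz : IsPeriodicGrid M (timeAvg z l))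
    (h0 : CompactPair M h (e l) (r l)) (h1 : CompactPair M h (e (l + 1)) (r (l + 1))) :
    2 * τ * (h * ∑ p ∈ Finset.Icc (1 : ℤ) M, schemeLHS μ lam τ h v z e r l p * timeAvg e l p)
      = energy μ M h (e (l + 1)) (r (l + 1)) - energy μ M h (e l) (r l)
        - 2 * τ * lam * (h * ∑ p ∈ Finset.Icc (1 : ℤ) M, timeAvg r l p * timeAvg e l p) := by
  have hp := h0.timeAvg h1
  have s1 := sum_psi_mul_self (h := h) hv hp.periodic_left
  have s2 := sum_psi_mul_self (h := h) hz hp.periodic_left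
  have s3 := sum_centralDiff_mul (h := h) hp.periodic_left hp.periodic_left
  have s4 := hp.sum_centralDiff_mul
  -- Symmetry cancels the mixed products of levels `l` and `l + 1`, so that the `μ` term becomes an
  -- exact difference of energies.
  have s5 := h0.sum_mul_comm h1
  have s3' : ∑ p ∈ Finset.Icc (1 : ℤ) M, centralDiff h (timeAvg e l) p * timeAvg e l p = 0 := by
    have : ∑ p ∈ Finset.Icc (1 : ℤ) M, timeAvg e l p * centralDiff h (timeAvg e l) p
        = ∑ p ∈ Finset.Icc (1 : ℤ) M, centralDiff h (timeAvg e l) p * timeAvg e l p :=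
      Finset.sum_congr rfl fun p _ => mul_comm _ _
    rw [this] at s3
    linarith
  have e1 : ∀ p, schemeLHS μ lam τ h v z e r l p * timeAvg e l p
      = ((e (l + 1) p ^ 2 - μ * (r (l + 1) p * e (l + 1) p))
          - (e l p ^ 2 - μ * (r l p * e l p))) / (2 * τ)
        - μ / (2 * τ) * (r (l + 1) p * e l p) + μ / (2 * τ) * (r l p * e (l + 1) p)
        + psi h (timeAvg v l) (timeAvg e l) p * timeAvg e l p
        - h ^ 2 / 2 * (psi h (timeAvg z l) (timeAvg e l) p * timeAvg e l p)
        + centralDiff h (timeAvg e l) p * timeAvg e l p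
        - h ^ 2 / 6 * (centralDiff h (timeAvg r l) p * timeAvg e l p)
        - lam * (timeAvg r l p * timeAvg e l p) := by
    intro p
    have : (timeDiff τ e l p - μ * timeDiff τ r l p) * timeAvg e l p
        = ((e (l + 1) p ^ 2 - μ * (r (l + 1) p * e (l + 1) p))
          - (e l p ^ 2 - μ * (r l p * e l p))) / (2 * τ)
        - μ / (2 * τ) * (r (l + 1) p * e l p) + μ / (2 * τ) * (r l p * e (l + 1) p) := by
      simp only [timeDiff, timeAvg]
      field_simp
      ring
    rw [← this, schemeLHS]
    ring
  simp only [e1]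
  rw [Finset.sum_sub_distrib, Finset.sum_sub_distrib, Finset.sum_add_distrib,
    Finset.sum_sub_distrib, Finset.sum_add_distrib, Finset.sum_add_distrib,
    Finset.sum_sub_distrib, ← Finset.sum_div, Finset.sum_sub_distrib,
    ← Finset.mul_sum, ← Finset.mul_sum, ← Finset.mul_sum, ← Finset.mul_sum, ← Finset.mul_sum,
    s1, s2, s3', s4, s5, energy, energy]
  field_simp
  ring

/-- The energy of solutions of the scheme does not increase. -/
theorem energy_succ_le (hlam : 0 ≤ lam) (hτ : 0 < τ) (hh : 0 < h)
    {v z e r : ℕ → ℤ → ℝ} {l : ℕ}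
    (hv : IsPeriodicGrid M (timeAvg v l)) (hz : IsPeriodicGrid M (timeAvg z l))
    (h0 : CompactPair M h (e l) (r l)) (h1 : CompactPair M h (e (l + 1)) (r (l + 1))) :
    energy μ M h (e (l + 1)) (r (l + 1)) ≤ energy μ M h (e l) (r l)
      + 2 * τ * (h * ∑ p ∈ Finset.Icc (1 : ℤ) M,
          schemeLHS μ lam τ h v z e r l p * timeAvg e l p) := by
  have := (h0.timeAvg h1).sum_deltaHalf_sq_le hh
  have h2 : 0 ≤ ∑ p ∈ Finset.Icc (1 : ℤ) M, deltaHalf h (timeAvg e l) p ^ 2 := by positivity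
  have h3 : 0 ≤ 2 * τ * lam * h * -∑ p ∈ Finset.Icc (1 : ℤ) M, timeAvg r l p * timeAvg e l p :=
    mul_nonneg (by positivity) (h2.trans this)
  rw [sum_schemeLHS_mul_timeAvg hτ.ne' hv hz h0 h1]
  linarith

/-- The difference acting on the product `ε U` is moved to the test function `e`, so no difference
of `ε` remains. The factor `s` allows one estimate to serve for `-Ψ(ε,U)` with `s = -1` and for
`(h²/2) Ψ(ζ,U)` with `s = h²/2`. -/
theorem neg_sum_psi_mul_le {B : ℝ} (hB : 0 ≤ B) {ε U e : ℤ → ℝ} (hε : IsPeriodicGrid M ε)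
    (hU : IsPeriodicGrid M U) (he : IsPeriodicGrid M e) (hUB : ∀ p, |U p| ≤ B)
    (hDB : ∀ p, |centralDiff h U p| ≤ B) (s : ℝ) :
    s * ∑ p ∈ Finset.Icc (1 : ℤ) M, psi h ε U p * e p
      ≤ B / 3 * (s ^ 2 * ∑ p ∈ Finset.Icc (1 : ℤ) M, ε p ^ 2
        + 1 / 2 * ∑ p ∈ Finset.Icc (1 : ℤ) M, e p ^ 2
        + 1 / 2 * ∑ p ∈ Finset.Icc (1 : ℤ) M, deltaHalf h e p ^ 2) := by
  have h1 := sum_centralDiff_mul (h := h) (v := fun q => ε q * U q) (w := e)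
    (hε.comp₂ hU fun a b => a * b) he
  have h2 := sum_centralDiff_sq_le (h := h) he
  have e1 : ∑ p ∈ Finset.Icc (1 : ℤ) M, psi h ε U p * e p
      = ∑ p ∈ Finset.Icc (1 : ℤ) M,
        (ε p * centralDiff h U p * e p - ε p * U p * centralDiff h e p) / 3 := by
    simp only [psi, div_mul_eq_mul_div, add_mul]
    rw [← Finset.sum_div, Finset.sum_add_distrib, h1, ← sub_eq_add_neg, ← Finset.sum_sub_distrib,
      Finset.sum_div]
  have key : ∀ p ∈ Finset.Icc (1 : ℤ) M,
      s * ((ε p * centralDiff h U p * e p - ε p * U p * centralDiff h e p) / 3)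
      ≤ B / 3 * (s ^ 2 * ε p ^ 2 + 1 / 2 * e p ^ 2 + 1 / 2 * centralDiff h e p ^ 2) := by
    intro p _
    have a1 : s * ε p * e p * centralDiff h U p
        ≤ (s ^ 2 * ε p ^ 2 + e p ^ 2) / 2 * B := by
      calc _ ≤ |s * ε p * e p| * |centralDiff h U p| := by rw [← abs_mul]; exact le_abs_self _
        _ ≤ _ := by
          gcongr
          · exact abs_le.2 ⟨by nlinarith [sq_nonneg (s * ε p + e p)],
              by nlinarith [sq_nonneg (s * ε p - e p)]⟩
          · exact hDB p
    have a2 : -(s * ε p * centralDiff h e p * U p)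
        ≤ (s ^ 2 * ε p ^ 2 + centralDiff h e p ^ 2) / 2 * B := by
      calc _ ≤ |s * ε p * centralDiff h e p| * |U p| := by
            rw [← abs_mul]; exact neg_le_abs _
        _ ≤ _ := by
          gcongr
          · exact abs_le.2 ⟨by nlinarith [sq_nonneg (s * ε p + centralDiff h e p)],
              by nlinarith [sq_nonneg (s * ε p - centralDiff h e p)]⟩
          · exact hUB p
    linarith
  have h3 := Finset.sum_le_sum key
  rw [← Finset.mul_sum, ← Finset.mul_sum, Finset.sum_add_distrib, Finset.sum_add_distrib,
    ← Finset.mul_sum, ← Finset.mul_sum, ← Finset.mul_sum] at h3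
  rw [e1]
  refine h3.trans ?_
  gcongr

/-- Growth of the energy of the error in one step. -/
theorem energy_error_succ_le {B : ℝ} (hB : 0 ≤ B) (hμ : 0 < μ) (hlam : 0 ≤ lam) (hτ : 0 < τ)
    (hh : 0 < h) {v z e r : ℕ → ℤ → ℝ} {ε ζ U R : ℤ → ℝ} {l : ℕ}
    (hv : IsPeriodicGrid M (timeAvg v l)) (hz : IsPeriodicGrid M (timeAvg z l))
    (h0 : CompactPair M h (e l) (r l)) (h1 : CompactPair M h (e (l + 1)) (r (l + 1)))
    (hε : CompactPair M h ε ζ) (hU : IsPeriodicGrid M U) (hUB : ∀ p, |U p| ≤ B)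
    (hDB : ∀ p, |centralDiff h U p| ≤ B)
    (heq : ∀ p ∈ Set.Icc (1 : ℤ) M, schemeLHS μ lam τ h v z e r l p
      = R p - psi h ε U p + h ^ 2 / 2 * psi h ζ U p) :
    energy μ M h (e (l + 1)) (r (l + 1)) - energy μ M h (e l) (r l)
      ≤ τ * ((1 / 2 + B / 3 + B / (3 * μ))
          * (energy μ M h (e (l + 1)) (r (l + 1)) + energy μ M h (e l) (r l))
        + (h * ∑ p ∈ Finset.Icc (1 : ℤ) M, R p ^ 2
          + 20 * B / 3 * (h * ∑ p ∈ Finset.Icc (1 : ℤ) M, ε p ^ 2))) := by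
  have hp := h0.timeAvg h1
  have a1 := energy_succ_le (μ := μ) hlam hτ hh hv hz h0 h1
  have a2 := neg_sum_psi_mul_le hB hε.periodic_left hU hp.periodic_left hUB hDB (-1)
  have a3 := neg_sum_psi_mul_le hB hε.periodic_right hU hp.periodic_left hUB hDB (h ^ 2 / 2)
  have a4 := hε.sum_sq_right_le hh
  have a5 := hp.le_energy hμ.le hh
  have a6 := energy_timeAvg_le hμ.le hh h0 h1
  set EA := energy μ M h (timeAvg e l) (timeAvg r l)
  set sE := ∑ p ∈ Finset.Icc (1 : ℤ) M, timeAvg e l p ^ 2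
  set sD := ∑ p ∈ Finset.Icc (1 : ℤ) M, deltaHalf h (timeAvg e l) p ^ 2
  have hsE : 0 ≤ h * sE := by positivity
  have hsD : 0 ≤ h * sD := by positivity
  have e1 : ∑ p ∈ Finset.Icc (1 : ℤ) M, schemeLHS μ lam τ h v z e r l p * timeAvg e l p
      ≤ 1 / 2 * ∑ p ∈ Finset.Icc (1 : ℤ) M, R p ^ 2 + 1 / 2 * sE
        + -1 * ∑ p ∈ Finset.Icc (1 : ℤ) M, psi h ε U p * timeAvg e l p
        + h ^ 2 / 2 * ∑ p ∈ Finset.Icc (1 : ℤ) M, psi h ζ U p * timeAvg e l p := by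
    rw [Finset.mul_sum, Finset.mul_sum, Finset.mul_sum, Finset.mul_sum, ← Finset.sum_add_distrib,
      ← Finset.sum_add_distrib, ← Finset.sum_add_distrib]
    refine Finset.sum_le_sum fun p hp' => ?_
    rw [heq p (by simpa using hp')]
    nlinarith [sq_nonneg (R p - timeAvg e l p)]
  -- From `h⁴‖ζ‖² ≤ 36‖ε‖²`. With the contribution of `s = -1` this makes the factor `10 = 1 + 9` in
  -- the next estimate.
  have e2 : (h ^ 2 / 2) ^ 2 * ∑ p ∈ Finset.Icc (1 : ℤ) M, ζ p ^ 2
      ≤ 9 * ∑ p ∈ Finset.Icc (1 : ℤ) M, ε p ^ 2 := by linarith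
  have e3 : ∑ p ∈ Finset.Icc (1 : ℤ) M, schemeLHS μ lam τ h v z e r l p * timeAvg e l p
      ≤ 1 / 2 * ∑ p ∈ Finset.Icc (1 : ℤ) M, R p ^ 2 + 1 / 2 * sE
        + B / 3 * (10 * ∑ p ∈ Finset.Icc (1 : ℤ) M, ε p ^ 2 + sE + sD) := by
    have := mul_le_mul_of_nonneg_left e2 (by positivity : 0 ≤ B / 3)
    linarith
  have e4 : h * sE ≤ EA := by nlinarith
  have e5 : h * sD ≤ EA / μ := by rw [le_div_iff₀ hμ]; linarith
  have e6 : h * ∑ p ∈ Finset.Icc (1 : ℤ) M, schemeLHS μ lam τ h v z e r l p * timeAvg e l p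
      ≤ 1 / 2 * (h * ∑ p ∈ Finset.Icc (1 : ℤ) M, R p ^ 2)
        + 10 * B / 3 * (h * ∑ p ∈ Finset.Icc (1 : ℤ) M, ε p ^ 2)
        + (1 / 2 + B / 3 + B / (3 * μ)) * EA := by
    have b1 := mul_le_mul_of_nonneg_left e3 hh.le
    have b2 := mul_le_mul_of_nonneg_left e4 (by positivity : 0 ≤ B / 3)
    have b3 := mul_le_mul_of_nonneg_left e5 (by positivity : 0 ≤ B / 3)
    have b4 : B / 3 * (EA / μ) = B / (3 * μ) * EA := by field_simp
    linarith
  have e7 := mul_le_mul_of_nonneg_left a6 (by positivity : 0 ≤ 1 / 2 + B / 3 + B / (3 * μ))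
  have e8 := mul_le_mul_of_nonneg_left (e6.trans (add_le_add_right e7 _))
    (by positivity : 0 ≤ 2 * τ)
  linarith

end Energy

/-- A discrete Gronwall inequality of Crank-Nicolson type. -/
theorem discrete_gronwall {x : ℕ → ℝ} {N : ℕ} {τ K F T : ℝ} (hτ : 0 ≤ τ) (hK : 0 ≤ K)
    (hF : 0 ≤ F) (hτK : τ * K ≤ 1 / 2) (hN : N * τ ≤ T) (hx : ∀ n ≤ N, 0 ≤ x n) (h0 : x 0 = 0)
    (hstep : ∀ n < N, x (n + 1) - x n ≤ τ * (K * (x (n + 1) + x n) + F)) :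
    ∀ n ≤ N, x n ≤ 2 * T * Real.exp (4 * K * T) * F := by
  have key : ∀ n ≤ N, x n ≤ 2 * (n * τ) * Real.exp (4 * K * (n * τ)) * F := by
    intro n
    induction n with
    | zero => intro _; simp [h0]
    | succ n ih =>
      intro hn
      have ih' := ih (by omega)
      have hs := hstep n (by omega)
      have hxn := hx n (by omega)
      have hxs := hx (n + 1) hn
      -- For `0 ≤ y ≤ 1/2` one has `1 + y ≤ (1 - y)(1 + 4y)` and `1 ≤ 2(1 - y)`; this solves the
      -- implicit step with `y = τK`.
      have h1 : x (n + 1) ≤ (1 + 4 * (τ * K)) * x n + 2 * (τ * F) := by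
        have hy : 0 ≤ τ * K := by positivity
        have hz : 0 ≤ τ * F := by positivity
        have h2 : (1 - τ * K) * x (n + 1) ≤ (1 + τ * K) * x n + τ * F := by linarith
        have h3 : (1 + τ * K) * x n + τ * F
            ≤ (1 - τ * K) * ((1 + 4 * (τ * K)) * x n + 2 * (τ * F)) := by
          nlinarith [mul_nonneg (mul_nonneg hy (by linarith : 0 ≤ 1 - 2 * (τ * K))) hxn,
            mul_nonneg (by linarith : 0 ≤ 1 - 2 * (τ * K)) hz]
        exact le_of_mul_le_mul_left (h2.trans h3) (by linarith)
      have h4 : 1 + 4 * (τ * K) ≤ Real.exp (4 * K * τ) := by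
        have := Real.add_one_le_exp (4 * K * τ); linarith
      have h5 : Real.exp (4 * K * ((n + 1 : ℕ) * τ))
          = Real.exp (4 * K * τ) * Real.exp (4 * K * (n * τ)) := by
        rw [← Real.exp_add]; congr 1; push_cast; ring
      have h6 : 1 ≤ Real.exp (4 * K * ((n + 1 : ℕ) * τ)) := Real.one_le_exp (by positivity)
      calc x (n + 1) ≤ (1 + 4 * (τ * K)) * x n + 2 * (τ * F) := h1
        _ ≤ Real.exp (4 * K * τ) * (2 * (n * τ) * Real.exp (4 * K * (n * τ)) * F)
            + 2 * (τ * F) * Real.exp (4 * K * ((n + 1 : ℕ) * τ)) := by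
          refine add_le_add (mul_le_mul h4 ih' hxn (by positivity)) ?_
          exact le_mul_of_one_le_right (by positivity) h6
        _ = _ := by rw [h5]; push_cast; ring
  intro n hn
  have h1 : (n : ℝ) * τ ≤ T := le_trans (by gcongr) hN
  have hT : 0 ≤ T := le_trans (by positivity) h1
  refine (key n hn).trans ?_
  gcongr

/-! ### Smooth functions with spatial period -/

/-- Functions which are smooth on `ℝ × [0, T]` and have spatial period `L`. -/
structure SmoothPeriodic (L T : ℝ) (F : ℝ → ℝ → ℝ) : Prop where
  smooth : ContDiffOn ℝ ∞ (fun z : ℝ × ℝ => F z.1 z.2) (Set.univ ×ˢ Set.Icc (0 : ℝ) T)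
  periodic : ∀ x, ∀ t ∈ Set.Icc (0 : ℝ) T, F (x + L) t = F x t

/-- Periodicity is given only for `t > 0`; it reaches `t = 0` by continuity in time. -/
theorem IsSmoothSolution.smoothPeriodic {μ lam L T : ℝ} (hT : 0 < T) {φ : ℝ → ℝ} {u : ℝ → ℝ → ℝ}
    (hu : IsSmoothSolution μ lam L T φ u) : SmoothPeriodic L T u := by
  refine ⟨hu.smooth, fun x t ht => ?_⟩
  rcases ht.1.eq_or_lt with h0 | h0
  · subst h0
    have hc : ∀ y, Filter.Tendsto (fun s => u y s) (nhdsWithin 0 (Set.Ioc 0 T)) (nhds (u y 0)) := by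
      intro y
      have h1 : ContinuousOn (fun s => u y s) (Set.Icc 0 T) :=
        hu.smooth.continuousOn.comp (f := fun s : ℝ => (y, s)) (by fun_prop)
          fun s hs => ⟨Set.mem_univ _, hs⟩
      exact (h1 0 ht).mono_left (nhdsWithin_mono _ Set.Ioc_subset_Icc_self)
    have : (nhdsWithin (0 : ℝ) (Set.Ioc 0 T)).NeBot := by
      rw [← mem_closure_iff_nhdsWithin_neBot, closure_Ioc hT.ne]
      exact ht
    refine tendsto_nhds_unique ((hc (x + L)).congr' ?_) (hc x)
    filter_upwards [self_mem_nhdsWithin] with s hs using hu.periodic x s hs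
  · exact hu.periodic x t ⟨h0, ht.2⟩

namespace SmoothPeriodic

variable {L T : ℝ} {F : ℝ → ℝ → ℝ}

/-- Continuity on the compact set of one period times `[0, T]`, followed by reduction modulo `L`. -/
theorem exists_abs_le (hL : 0 < L) (hF : SmoothPeriodic L T F) :
    ∃ B, ∀ x, ∀ t ∈ Set.Icc (0 : ℝ) T, |F x t| ≤ B := by
  have hK : IsCompact (Set.Icc 0 L ×ˢ Set.Icc (0 : ℝ) T) := isCompact_Icc.prod isCompact_Icc
  obtain ⟨B, hB⟩ := hK.exists_bound_of_continuousOn (f := fun z : ℝ × ℝ => F z.1 z.2)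
    (hF.smooth.continuousOn.mono (Set.prod_mono (Set.subset_univ _) le_rfl))
  refine ⟨B, fun x t ht => ?_⟩
  have hper : Function.Periodic (fun y => F y t) L := fun y => hF.periodic y t ht
  obtain ⟨y, hy, hxy⟩ := hper.exists_mem_Ico₀ hL x
  rw [hxy]
  exact hB (y, t) ⟨⟨hy.1, hy.2.le⟩, ht⟩

theorem uniqueDiffOn (hT : 0 < T) :
    UniqueDiffOn ℝ ((Set.univ : Set ℝ) ×ˢ Set.Icc (0 : ℝ) T) :=
  uniqueDiffOn_univ.prod (uniqueDiffOn_Icc hT)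

theorem hasFDerivWithinAt (hF : SmoothPeriodic L T F) {x t : ℝ} (ht : t ∈ Set.Icc (0 : ℝ) T) :
    HasFDerivWithinAt (fun z : ℝ × ℝ => F z.1 z.2)
      (fderivWithin ℝ (fun z : ℝ × ℝ => F z.1 z.2) (Set.univ ×ˢ Set.Icc (0 : ℝ) T) (x, t))
      (Set.univ ×ˢ Set.Icc (0 : ℝ) T) (x, t) :=
  ((hF.smooth.differentiableOn (by simp)) (x, t) ⟨Set.mem_univ _, ht⟩).hasFDerivWithinAt

theorem hasDerivAt_fderivWithin (hF : SmoothPeriodic L T F) {x t : ℝ}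
    (ht : t ∈ Set.Icc (0 : ℝ) T) :
    HasDerivAt (fun y => F y t)
      (fderivWithin ℝ (fun z : ℝ × ℝ => F z.1 z.2) (Set.univ ×ˢ Set.Icc (0 : ℝ) T) (x, t) (1, 0))
      x := by
  have h1 : HasDerivWithinAt (fun y : ℝ => (y, t)) ((1 : ℝ), (0 : ℝ)) Set.univ x :=
    ((hasDerivAt_id x).prodMk (hasDerivAt_const x t)).hasDerivWithinAt
  rw [← hasDerivWithinAt_univ]
  exact (hF.hasFDerivWithinAt (x := x) ht).comp_hasDerivWithinAt x h1
    fun y _ => Set.mk_mem_prod (Set.mem_univ _) ht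

theorem hasDerivWithinAt_fderivWithin (hF : SmoothPeriodic L T F) {x t : ℝ}
    (ht : t ∈ Set.Icc (0 : ℝ) T) :
    HasDerivWithinAt (fun s => F x s)
      (fderivWithin ℝ (fun z : ℝ × ℝ => F z.1 z.2) (Set.univ ×ˢ Set.Icc (0 : ℝ) T) (x, t) (0, 1))
      (Set.Icc 0 T) t := by
  have h1 : HasDerivWithinAt (fun s : ℝ => (x, s)) ((0 : ℝ), (1 : ℝ)) (Set.Icc 0 T) t :=
    ((hasDerivAt_const t x).prodMk (hasDerivAt_id t)).hasDerivWithinAt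
  exact (hF.hasFDerivWithinAt (x := x) ht).comp_hasDerivWithinAt t h1
    fun y hy => ⟨Set.mem_univ _, hy⟩

theorem contDiffOn_fderivWithin_apply (hT : 0 < T) (hF : SmoothPeriodic L T F) (v : ℝ × ℝ) :
    ContDiffOn ℝ ∞ (fun z => fderivWithin ℝ (fun z : ℝ × ℝ => F z.1 z.2)
      (Set.univ ×ˢ Set.Icc (0 : ℝ) T) z v) (Set.univ ×ˢ Set.Icc (0 : ℝ) T) :=
  (hF.smooth.fderivWithin (uniqueDiffOn hT) (by simp)).clm_apply contDiffOn_const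

theorem hasDerivAt_dx_one (hF : SmoothPeriodic L T F) {x t : ℝ} (ht : t ∈ Set.Icc (0 : ℝ) T) :
    HasDerivAt (fun y => F y t) (dx 1 F x t) x := by
  rw [dx, iteratedDeriv_one]
  exact (hF.hasDerivAt_fderivWithin ht).differentiableAt.hasDerivAt

theorem hasDerivWithinAt_dt (hF : SmoothPeriodic L T F) {x t : ℝ} (ht : t ∈ Set.Icc (0 : ℝ) T) :
    HasDerivWithinAt (fun s => F x s) (dt T F x t) (Set.Icc 0 T) t :=
  (hF.hasDerivWithinAt_fderivWithin ht).differentiableWithinAt.hasDerivWithinAt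

/-- The partial derivative is the joint derivative within the strip applied to `(1, 0)`, hence
smooth again. Differentiating the translated function gives periodicity. `dt` below is treated in
the same way with direction `(0, 1)`. -/
theorem dx_one (hT : 0 < T) (hF : SmoothPeriodic L T F) : SmoothPeriodic L T (dx 1 F) := by
  refine ⟨(hF.contDiffOn_fderivWithin_apply hT (1, 0)).congr fun z hz =>
    (hF.hasDerivAt_dx_one hz.2).unique (hF.hasDerivAt_fderivWithin hz.2), fun x t ht => ?_⟩
  have h1 := (hF.hasDerivAt_dx_one (x := x + L) ht).comp_add_const x L
  have h2 : (fun y => F (y + L) t) = fun y => F y t := funext fun y => hF.periodic y t ht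
  rw [h2] at h1
  exact h1.unique (hF.hasDerivAt_dx_one ht)

theorem dt (hT : 0 < T) (hF : SmoothPeriodic L T F) : SmoothPeriodic L T (dt T F) := by
  refine ⟨(hF.contDiffOn_fderivWithin_apply hT (0, 1)).congr fun z hz =>
    (uniqueDiffOn_Icc hT z.2 hz.2).eq_deriv _ (hF.hasDerivWithinAt_dt hz.2)
      (hF.hasDerivWithinAt_fderivWithin hz.2), fun x t ht => ?_⟩
  have h1 := (hF.hasDerivWithinAt_dt (x := x) ht).congr (f₁ := fun s => F (x + L) s)
    (fun s hs => hF.periodic x s hs) (hF.periodic x t ht)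
  exact (uniqueDiffOn_Icc hT t ht).eq_deriv _ (hF.hasDerivWithinAt_dt ht) h1

end SmoothPeriodic

/-! ### Iterated partial derivatives in space and time. -/

theorem dx_zero (F : ℝ → ℝ → ℝ) : dx 0 F = F := by
  ext x t; simp [dx]

theorem dx_succ (j : ℕ) (F : ℝ → ℝ → ℝ) : dx (j + 1) F = dx 1 (dx j F) := by
  ext x t
  simp only [dx, iteratedDeriv_succ, iteratedDeriv_zero]

/-- Iterated partial derivatives in time. -/
def dtIter (T : ℝ) (i : ℕ) (F : ℝ → ℝ → ℝ) : ℝ → ℝ → ℝ := (dt T)^[i] F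

theorem dtIter_succ (T : ℝ) (i : ℕ) (F : ℝ → ℝ → ℝ) :
    dtIter T (i + 1) F = dt T (dtIter T i F) := Function.iterate_succ_apply' _ _ _

namespace SmoothPeriodic

variable {L T : ℝ} {F : ℝ → ℝ → ℝ}

theorem dx (hT : 0 < T) (hF : SmoothPeriodic L T F) (j : ℕ) : SmoothPeriodic L T (dx j F) := by
  induction j with
  | zero => rwa [dx_zero]
  | succ j ih => rw [dx_succ]; exact ih.dx_one hT

theorem dtIter (hT : 0 < T) (hF : SmoothPeriodic L T F) (i : ℕ) :
    SmoothPeriodic L T (dtIter T i F) := by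
  induction i with
  | zero => exact hF
  | succ i ih => rw [dtIter_succ]; exact ih.dt hT

theorem hasDerivAt_dx (hT : 0 < T) (hF : SmoothPeriodic L T F) (j : ℕ) {x t : ℝ}
    (ht : t ∈ Set.Icc (0 : ℝ) T) :
    HasDerivAt (fun y => BBMB.dx j F y t) (BBMB.dx (j + 1) F x t) x := by
  rw [dx_succ]; exact (hF.dx hT j).hasDerivAt_dx_one ht

theorem hasDerivWithinAt_dtIter (hT : 0 < T) (hF : SmoothPeriodic L T F) (i : ℕ) {x t : ℝ}
    (ht : t ∈ Set.Icc (0 : ℝ) T) :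
    HasDerivWithinAt (fun s => BBMB.dtIter T i F x s) (BBMB.dtIter T (i + 1) F x t)
      (Set.Icc 0 T) t := by
  rw [dtIter_succ]; exact (hF.dtIter hT i).hasDerivWithinAt_dt ht

/-- A common bound for the derivatives of order at most `6` in space and `3` in time. -/
theorem exists_bound (hL : 0 < L) (hT : 0 < T) (hF : SmoothPeriodic L T F) :
    ∃ B, 0 < B ∧ ∀ i ≤ 3, ∀ j ≤ 6, ∀ x, ∀ t ∈ Set.Icc (0 : ℝ) T,
      |BBMB.dtIter T i (BBMB.dx j F) x t| ≤ B := by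
  choose b hb using fun i j => ((hF.dx hT j).dtIter hT i).exists_abs_le hL
  have hb0 : ∀ i j, 0 ≤ b i j := fun i j => (abs_nonneg _).trans (hb i j 0 0 ⟨le_rfl, hT.le⟩)
  refine ⟨∑ i ∈ Finset.range 4, ∑ j ∈ Finset.range 7, b i j + 1, ?_, fun i hi j hj x t ht => ?_⟩
  · have := Finset.sum_nonneg fun i (_ : i ∈ Finset.range 4) =>
      Finset.sum_nonneg fun j (_ : j ∈ Finset.range 7) => hb0 i j
    linarith
  · have h1 := Finset.single_le_sum (f := fun j => b i j) (fun j _ => hb0 i j)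
      (Finset.mem_range.2 (Nat.lt_succ_of_le hj))
    have h2 := Finset.single_le_sum (f := fun i => ∑ j ∈ Finset.range 7, b i j)
      (fun i _ => Finset.sum_nonneg fun j _ => hb0 i j) (Finset.mem_range.2 (Nat.lt_succ_of_le hi))
    linarith [hb i j x t ht]

end SmoothPeriodic

/-! ### Taylor expansions -/

/-- Induction on the order: the derivative of the remainder is the remainder of the sequence shifted
by one, and the mean value inequality supplies one more factor `|t - c|`. The factorial in the
remainder is given up. Derivatives within an order-connected set suffice, so the endpoints of `[0,
T]` are covered. -/
theorem abs_sub_taylor_le {s : Set ℝ} (hs : s.OrdConnected) {B : ℝ} (hB : 0 ≤ B) (n : ℕ) :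
    ∀ {F : ℕ → ℝ → ℝ}, (∀ j < n, ∀ t ∈ s, HasDerivWithinAt (F j) (F (j + 1) t) s t) →
      (∀ t ∈ s, |F n t| ≤ B) → ∀ {c t : ℝ}, c ∈ s → t ∈ s →
      |F 0 t - ∑ j ∈ Finset.range n, F j c * (t - c) ^ j / (j.factorial : ℝ)| ≤ B * |t - c| ^ n := by
  induction n with
  | zero => intro F _ hFB c t _ ht; simpa using hFB t ht
  | succ n ih =>
    intro F hF hFB c t hc ht
    have hsub : Set.uIcc c t ⊆ s := hs.uIcc_subset hc ht
    have hd : ∀ y ∈ Set.uIcc c t, HasDerivWithinAt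
        (fun y => F 0 y - ∑ j ∈ Finset.range (n + 1), F j c * (y - c) ^ j / (j.factorial : ℝ))
        (F 1 y - ∑ j ∈ Finset.range n, F (j + 1) c * (y - c) ^ j / (j.factorial : ℝ)) (Set.uIcc c t) y := by
      intro y hy
      refine ((hF 0 (by omega) y (hsub hy)).mono hsub).sub ?_
      simp only [Finset.sum_range_succ' _ n, pow_zero]
      refine HasDerivAt.hasDerivWithinAt (HasDerivAt.add_const _ (HasDerivAt.fun_sum fun j _ => ?_))
      have h1 := ((((hasDerivAt_id y).sub_const c).pow (j + 1)).const_mul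
        (F (j + 1) c)).div_const ((j + 1).factorial : ℝ)
      refine h1.congr_deriv ?_
      rw [Nat.factorial_succ]
      push_cast
      have := Nat.factorial_ne_zero j
      have : (j.factorial : ℝ) ≠ 0 := by exact_mod_cast this
      have : (j : ℝ) + 1 ≠ 0 := by positivity
      simp only [id, mul_one]
      field_simp
    have hb : ∀ y ∈ Set.uIcc c t,
        ‖F 1 y - ∑ j ∈ Finset.range n, F (j + 1) c * (y - c) ^ j / (j.factorial : ℝ)‖ ≤ B * |t - c| ^ n := by
      intro y hy
      refine (ih (F := fun j => F (j + 1)) (fun j hj t ht => hF (j + 1) (by omega) t ht) hFB hc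
        (hsub hy)).trans ?_
      have : |y - c| ≤ |t - c| := Set.abs_sub_left_of_mem_uIcc hy
      gcongr
    have := (convex_uIcc c t).norm_image_sub_le_of_norm_hasDerivWithin_le hd hb
      Set.left_mem_uIcc Set.right_mem_uIcc
    rw [Real.norm_eq_abs, Real.norm_eq_abs] at this
    have hz : F 0 c - ∑ j ∈ Finset.range (n + 1), F j c * (c - c) ^ j / (j.factorial : ℝ) = 0 := by
      rw [Finset.sum_range_succ']
      simp
    rw [hz, sub_zero] at this
    rw [pow_succ, ← mul_assoc]
    exact this

/-! ### Consistency of the spatial operators -/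

/-- The successive derivatives `f 0, f 1, …, f 6` of a function, bounded by `B`. -/
structure BoundedJet (B : ℝ) (f : ℕ → ℝ → ℝ) : Prop where
  deriv : ∀ j < 6, ∀ x, HasDerivAt (f j) (f (j + 1) x) x
  bound : ∀ j ≤ 6, ∀ x, |f j x| ≤ B

/-- The grid values of a function of `x`. -/
def sample (a h : ℝ) (g : ℝ → ℝ) (p : ℤ) : ℝ := g (a + p * h)

theorem sample_add_one (a h : ℝ) (g : ℝ → ℝ) (p : ℤ) :
    sample a h g (p + 1) = g (a + p * h + h) := by
  unfold sample; push_cast; ring_nf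

theorem sample_sub_one (a h : ℝ) (g : ℝ → ℝ) (p : ℤ) :
    sample a h g (p - 1) = g (a + p * h - h) := by
  unfold sample; push_cast; ring_nf

theorem centralDiff_sample (a h : ℝ) (g : ℝ → ℝ) (p : ℤ) :
    centralDiff h (sample a h g) p = (g (a + p * h + h) - g (a + p * h - h)) / (2 * h) := by
  rw [centralDiff, sample_add_one, sample_sub_one]

theorem deltaXX_sample (a h : ℝ) (g : ℝ → ℝ) (p : ℤ) :
    deltaXX h (sample a h g) p
      = (g (a + p * h + h) - 2 * g (a + p * h) + g (a + p * h - h)) / h ^ 2 := by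
  rw [deltaXX_eq, sample_add_one, sample_sub_one, sample]

namespace BoundedJet

variable {B a h : ℝ} {f : ℕ → ℝ → ℝ}

theorem nonneg (hf : BoundedJet B f) : 0 ≤ B := (abs_nonneg _).trans (hf.bound 0 (by omega) 0)

theorem taylor (hf : BoundedJet B f) {i n : ℕ} (hin : i + n ≤ 6) (x s : ℝ) :
    |f i (x + s) - ∑ j ∈ Finset.range n, f (i + j) x * s ^ j / (j.factorial : ℝ)|
      ≤ B * |s| ^ n := by
  have := abs_sub_taylor_le (s := Set.univ) Set.ordConnected_univ hf.nonneg n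
    (F := fun j => f (i + j))
    (fun j hj t _ => (hf.deriv (i + j) (by omega) t).hasDerivWithinAt)
    (fun t _ => hf.bound (i + n) hin t) (c := x) (t := x + s) (Set.mem_univ _) (Set.mem_univ _)
  simpa using this

theorem taylor_pair (hf : BoundedJet B f) (hh : 0 < h) {i n : ℕ} (hin : i + n ≤ 6) (x : ℝ) :
    |f i (x + h) - ∑ j ∈ Finset.range n, f (i + j) x * h ^ j / (j.factorial : ℝ)| ≤ B * h ^ n ∧
    |f i (x - h) - ∑ j ∈ Finset.range n, f (i + j) x * (-h) ^ j / (j.factorial : ℝ)|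
      ≤ B * h ^ n := by
  have h1 := hf.taylor hin x h
  have h2 := hf.taylor hin x (-h)
  rw [abs_neg] at h2
  rw [abs_of_pos hh] at h1 h2
  exact ⟨h1, h2⟩

theorem abs_centralDiff_le (hf : BoundedJet B f) (hh : 0 < h) {i : ℕ} (hi : i ≤ 5) (p : ℤ) :
    |centralDiff h (sample a h (f i)) p| ≤ B := by
  obtain ⟨h1, h2⟩ := hf.taylor_pair hh (i := i) (n := 1) (by omega) (a + p * h)
  simp [abs_le] at h1 h2
  rw [centralDiff_sample, abs_div, abs_of_pos (by positivity : 0 < 2 * h),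
    div_le_iff₀ (by positivity), abs_le]
  constructor <;> linarith [h1.1, h1.2, h2.1, h2.2]

theorem abs_deltaXX_le (hf : BoundedJet B f) (hh : 0 < h) (p : ℤ) :
    |deltaXX h (sample a h (f 0)) p| ≤ 2 * B := by
  obtain ⟨h1, h2⟩ := hf.taylor_pair hh (i := 0) (n := 2) (by omega) (a + p * h)
  simp [abs_le, Finset.sum_range_succ, Nat.factorial] at h1 h2
  rw [deltaXX_sample, abs_div, abs_of_pos (by positivity : 0 < h ^ 2),
    div_le_iff₀ (by positivity), abs_le]
  constructor <;> linarith [h1.1, h1.2, h2.1, h2.2]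

/-- Consistency of the compact second difference. -/
theorem abs_compactOp_sub_deltaXX_le (hf : BoundedJet B f) (hh : 0 < h) (p : ℤ) :
    |compactOp h (sample a h (f 2)) p - deltaXX h (sample a h (f 0)) p| ≤ 3 * B * h ^ 4 := by
  -- Order six for the function, because its second difference is divided by `h²`, and order four
  -- for its second derivative. Odd terms cancel between `x + h` and `x - h`, and the even ones
  -- match the weights of the compact operator.
  obtain ⟨h1, h2⟩ := hf.taylor_pair hh (i := 0) (n := 6) (by omega) (a + p * h)
  obtain ⟨h3, h4⟩ := hf.taylor_pair hh (i := 2) (n := 4) (by omega) (a + p * h)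
  simp [abs_le, Finset.sum_range_succ, Nat.factorial] at h1 h2 h3 h4
  have hB := hf.nonneg
  have hB4 : 0 ≤ B * h ^ 6 := by positivity
  rw [compactOp_eq hh, sample_add_one, sample_sub_one, sample, deltaXX_sample]
  set x := a + p * h
  have e : ∀ A D : ℝ, A - D / h ^ 2 = (h ^ 2 * A - D) / h ^ 2 := by
    intro A D; field_simp
  rw [e, abs_div, abs_of_pos (by positivity : 0 < h ^ 2), div_le_iff₀ (by positivity), abs_le]
  have k1 := mul_le_mul_of_nonneg_left h3.1 (by positivity : 0 ≤ h ^ 2)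
  have k2 := mul_le_mul_of_nonneg_left h3.2 (by positivity : 0 ≤ h ^ 2)
  have k3 := mul_le_mul_of_nonneg_left h4.1 (by positivity : 0 ≤ h ^ 2)
  have k4 := mul_le_mul_of_nonneg_left h4.2 (by positivity : 0 ≤ h ^ 2)
  constructor <;> linarith [h1.1, h1.2, h2.1, h2.2]

/-- Consistency of the compact first difference. -/
theorem abs_centralDiff_sub_le (hf : BoundedJet B f) (hh : 0 < h) (p : ℤ) :
    |centralDiff h (sample a h (f 0)) p - h ^ 2 / 6 * centralDiff h (sample a h (f 2)) p
      - f 1 (a + p * h)| ≤ 2 * B * h ^ 4 := by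
  obtain ⟨h1, h2⟩ := hf.taylor_pair hh (i := 0) (n := 5) (by omega) (a + p * h)
  obtain ⟨h3, h4⟩ := hf.taylor_pair hh (i := 2) (n := 3) (by omega) (a + p * h)
  simp [abs_le, Finset.sum_range_succ, Nat.factorial] at h1 h2 h3 h4
  have hB := hf.nonneg
  have hB4 : 0 ≤ B * h ^ 5 := by positivity
  rw [centralDiff_sample, centralDiff_sample]
  set x := a + p * h
  have e : ∀ A D E : ℝ, A / (2 * h) - h ^ 2 / 6 * (D / (2 * h)) - E
      = (A - h ^ 2 / 6 * D - 2 * h * E) / (2 * h) := by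
    intro A D E; field_simp
  rw [e, abs_div, abs_of_pos (by positivity : 0 < 2 * h), div_le_iff₀ (by positivity), abs_le]
  have k1 := mul_le_mul_of_nonneg_left h3.1 (by positivity : 0 ≤ h ^ 2)
  have k2 := mul_le_mul_of_nonneg_left h3.2 (by positivity : 0 ≤ h ^ 2)
  have k3 := mul_le_mul_of_nonneg_left h4.1 (by positivity : 0 ≤ h ^ 2)
  have k4 := mul_le_mul_of_nonneg_left h4.2 (by positivity : 0 ≤ h ^ 2)
  constructor <;> linarith [h1.1, h1.2, h2.1, h2.2]

/-- Consistency of the discrete nonlinearity. -/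
theorem abs_psi_sub_le (hf : BoundedJet B f) (hh : 0 < h) (p : ℤ) :
    |psi h (sample a h (f 0)) (sample a h (f 0)) p
      - h ^ 2 / 2 * psi h (sample a h (f 2)) (sample a h (f 0)) p
      - f 0 (a + p * h) * f 1 (a + p * h)| ≤ 3 * B ^ 2 * h ^ 4 := by
  have hB := hf.nonneg
  obtain ⟨h1, h2⟩ := hf.taylor_pair hh (i := 0) (n := 5) (by omega) (a + p * h)
  obtain ⟨h3, h4⟩ := hf.taylor_pair hh (i := 2) (n := 3) (by omega) (a + p * h)
  obtain ⟨h5, h6⟩ := hf.taylor_pair hh (i := 0) (n := 4) (by omega) (a + p * h)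
  obtain ⟨h7, h8⟩ := hf.taylor_pair hh (i := 2) (n := 2) (by omega) (a + p * h)
  obtain ⟨h9, h10⟩ := hf.taylor_pair hh (i := 0) (n := 2) (by omega) (a + p * h)
  have hb := hf.abs_centralDiff_le hh (a := a) (i := 0) (by omega) p
  have hd := hf.abs_centralDiff_le hh (a := a) (i := 2) (by omega) p
  simp [abs_le, Finset.sum_range_succ, Nat.factorial] at h1 h2 h3 h4 h5 h6 h7 h8 h9 h10
  have q0 := hf.bound 0 (by omega) (a + p * h)
  unfold psi
  rw [centralDiff_sample] at hb hd
  rw [centralDiff_sample]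
  unfold centralDiff
  simp only [sample_add_one, sample_sub_one]
  simp only [sample]
  set x := a + p * h
  set fp := f 0 (x + h)
  set fm := f 0 (x - h)
  set wp := f 2 (x + h)
  set wm := f 2 (x - h)
  set b := (fp - fm) / (2 * h) with hbdef
  set d := (wp - wm) / (2 * h) with hddef
  have ebf : fp - fm = 2 * h * b := by rw [hbdef]; field_simp
  have edw : wp - wm = 2 * h * d := by rw [hddef]; field_simp
  have g1 : |2 / 3 * ((fp + fm) / 2 - f 0 x - h ^ 2 / 2 * f 2 x)
      - h ^ 2 / 6 * ((wp + wm) / 2 - f 2 x)| ≤ B * h ^ 4 := by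
    have k1 := mul_le_mul_of_nonneg_left h7.1 (by positivity : 0 ≤ h ^ 2)
    have k2 := mul_le_mul_of_nonneg_left h7.2 (by positivity : 0 ≤ h ^ 2)
    have k3 := mul_le_mul_of_nonneg_left h8.1 (by positivity : 0 ≤ h ^ 2)
    have k4 := mul_le_mul_of_nonneg_left h8.2 (by positivity : 0 ≤ h ^ 2)
    have hB4 : 0 ≤ B * h ^ 4 := by positivity
    rw [abs_le]
    constructor <;> linarith [h5.1, h5.2, h6.1, h6.2]
  have g2 : |b - f 1 x - h ^ 2 / 6 * f 3 x| ≤ B * h ^ 4 := by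
    have e : b - f 1 x - h ^ 2 / 6 * f 3 x
        = (fp - fm - 2 * h * f 1 x - h ^ 3 / 3 * f 3 x) / (2 * h) := by rw [hbdef]; field_simp; ring
    rw [e, abs_div, abs_of_pos (by positivity : 0 < 2 * h), div_le_iff₀ (by positivity), abs_le]
    constructor <;> linarith [h1.1, h1.2, h2.1, h2.2]
  have g3 : |d - f 3 x| ≤ B * h ^ 2 := by
    have e : d - f 3 x = (wp - wm - 2 * h * f 3 x) / (2 * h) := by rw [hddef]; field_simp
    rw [e, abs_div, abs_of_pos (by positivity : 0 < 2 * h), div_le_iff₀ (by positivity), abs_le]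
    constructor <;> linarith [h3.1, h3.2, h4.1, h4.2]
  have g4 : |(fp + fm) / 2 - f 0 x| ≤ B * h ^ 2 := by
    rw [abs_le]
    constructor <;> linarith [h9.1, h9.2, h10.1, h10.2]
  -- The identity `(fp² - fm²)/(2h) = (fp + fm) b` and the discrete product rule isolate three
  -- defects: that of the first difference, a combined defect of the averages, and a correction
  -- multiplied by `h²/6` whose bracket is itself of order `h²`. The `h²` terms cancel because of
  -- the compensating `-(h²/2) Ψ(f 2, f 0)`.
  have key : (f 0 x * b + (fp * fp - fm * fm) / (2 * h)) / 3
        - h ^ 2 / 2 * ((f 2 x * b + (wp * fp - wm * fm) / (2 * h)) / 3) - f 0 x * f 1 x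
      = f 0 x * (b - f 1 x - h ^ 2 / 6 * f 3 x)
        + (2 / 3 * ((fp + fm) / 2 - f 0 x - h ^ 2 / 2 * f 2 x)
            - h ^ 2 / 6 * ((wp + wm) / 2 - f 2 x)) * b
        - h ^ 2 / 6 * (f 0 x * (d - f 3 x) + ((fp + fm) / 2 - f 0 x) * d) := by
    have e1 : (fp * fp - fm * fm) / (2 * h) = (fp + fm) * b := by rw [hbdef]; ring
    have e2 : (wp * fp - wm * fm) / (2 * h) = (wp + wm) / 2 * b + (fp + fm) / 2 * d := by
      rw [hbdef, hddef]; ring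
    rw [e1, e2]
    ring
  rw [key]
  have m1 : |f 0 x * (b - f 1 x - h ^ 2 / 6 * f 3 x)| ≤ B * (B * h ^ 4) := by
    rw [abs_mul]; gcongr
  have m2 : |(2 / 3 * ((fp + fm) / 2 - f 0 x - h ^ 2 / 2 * f 2 x)
            - h ^ 2 / 6 * ((wp + wm) / 2 - f 2 x)) * b| ≤ B * h ^ 4 * B := by
    rw [abs_mul]; gcongr
  have m3 : |f 0 x * (d - f 3 x)| ≤ B * (B * h ^ 2) := by rw [abs_mul]; gcongr
  have m4 : |((fp + fm) / 2 - f 0 x) * d| ≤ B * h ^ 2 * B := by rw [abs_mul]; gcongr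
  have m5 := mul_le_mul_of_nonneg_left ((abs_add_le _ _).trans (add_le_add m3 m4))
    (by positivity : 0 ≤ h ^ 2 / 6)
  refine (abs_sub _ _).trans ((add_le_add ((abs_add_le _ _).trans (add_le_add m1 m2)) ?_).trans
    (?_ : _ + h ^ 2 / 6 * (B * (B * h ^ 2) + B * h ^ 2 * B) ≤ _))
  · rw [abs_mul, abs_of_nonneg (by positivity : 0 ≤ h ^ 2 / 6)]; exact m5
  · have : 0 ≤ B ^ 2 * h ^ 4 := by positivity
    linarith

end BoundedJet

/-! ### Time averages and differences -/

/-- The successive derivatives `g 0, …, g 3` of a function on `[0, T]`, bounded by `B`. -/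
structure BoundedTimeJet (T B : ℝ) (g : ℕ → ℝ → ℝ) : Prop where
  deriv : ∀ i < 3, ∀ t ∈ Set.Icc 0 T, HasDerivWithinAt (g i) (g (i + 1) t) (Set.Icc 0 T) t
  bound : ∀ i ≤ 3, ∀ t ∈ Set.Icc 0 T, |g i t| ≤ B

namespace BoundedTimeJet

variable {T B t₀ t₁ : ℝ} {g : ℕ → ℝ → ℝ}

theorem taylor (hg : BoundedTimeJet T B g) {n : ℕ} (hn : n ≤ 3) {c t : ℝ}
    (hc : c ∈ Set.Icc 0 T) (ht : t ∈ Set.Icc 0 T) :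
    |g 0 t - ∑ j ∈ Finset.range n, g j c * (t - c) ^ j / (j.factorial : ℝ)|
      ≤ B * |t - c| ^ n :=
  abs_sub_taylor_le (s := Set.Icc 0 T) Set.ordConnected_Icc
    ((abs_nonneg _).trans (hg.bound 0 (by omega) c hc)) n
    (fun j hj t ht => hg.deriv j (by omega) t ht) (fun t ht => hg.bound n hn t ht) hc ht

/-- Expand about the interpolation point itself: the first-order terms cancel under the weights `1 -
s` and `s`, and both endpoints lie within `t₁ - t₀` of it. -/
theorem abs_interp_sub_le (hg : BoundedTimeJet T B g) (h0 : t₀ ∈ Set.Icc 0 T)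
    (h1 : t₁ ∈ Set.Icc 0 T) {s : ℝ} (hs0 : 0 ≤ s) (hs1 : s ≤ 1) :
    |g 0 ((1 - s) * t₀ + s * t₁) - ((1 - s) * g 0 t₀ + s * g 0 t₁)| ≤ B * (t₁ - t₀) ^ 2 := by
  have hc : (1 - s) * t₀ + s * t₁ ∈ Set.Icc 0 T :=
    convex_Icc 0 T h0 h1 (by linarith) hs0 (by ring)
  have hB : 0 ≤ B := (abs_nonneg _).trans (hg.bound 0 (by omega) _ hc)
  have k0 := hg.taylor (n := 2) (by omega) hc h0
  have k1 := hg.taylor (n := 2) (by omega) hc h1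
  rw [sq_abs] at k0 k1
  simp [Finset.sum_range_succ] at k0 k1
  set c := (1 - s) * t₀ + s * t₁ with hcdef
  have e : g 0 c - ((1 - s) * g 0 t₀ + s * g 0 t₁)
      = -((1 - s) * (g 0 t₀ - (g 0 c + g 1 c * (t₀ - c)))
        + s * (g 0 t₁ - (g 0 c + g 1 c * (t₁ - c)))) := by
    rw [hcdef]; ring
  have e0 : (t₀ - c) ^ 2 ≤ (t₁ - t₀) ^ 2 := by
    rw [hcdef, show t₀ - ((1 - s) * t₀ + s * t₁) = s * (t₀ - t₁) by ring, mul_pow]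
    nlinarith [sq_nonneg (t₁ - t₀), mul_le_of_le_one_right hs0 hs1,
      mul_nonneg (sq_nonneg (t₁ - t₀)) (by nlinarith : 0 ≤ 1 - s ^ 2)]
  have e1 : (t₁ - c) ^ 2 ≤ (t₁ - t₀) ^ 2 := by
    rw [hcdef, show t₁ - ((1 - s) * t₀ + s * t₁) = (1 - s) * (t₁ - t₀) by ring, mul_pow]
    nlinarith [mul_nonneg (sq_nonneg (t₁ - t₀)) (by nlinarith : 0 ≤ 1 - (1 - s) ^ 2)]
  rw [e, abs_neg]
  refine (abs_add_le _ _).trans ?_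
  rw [abs_mul, abs_mul, abs_of_nonneg hs0, abs_of_nonneg (by linarith : 0 ≤ 1 - s)]
  have l0 := mul_le_mul_of_nonneg_left (k0.trans (mul_le_mul_of_nonneg_left e0 hB))
    (by linarith : 0 ≤ 1 - s)
  have l1 := mul_le_mul_of_nonneg_left (k1.trans (mul_le_mul_of_nonneg_left e1 hB)) hs0
  linarith

theorem abs_avg_sub_le (hg : BoundedTimeJet T B g) (h0 : t₀ ∈ Set.Icc 0 T)
    (h1 : t₁ ∈ Set.Icc 0 T) :
    |(g 0 t₁ + g 0 t₀) / 2 - g 0 ((t₀ + t₁) / 2)| ≤ B * (t₁ - t₀) ^ 2 := by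
  have := hg.abs_interp_sub_le h0 h1 (s := 1 / 2) (by norm_num) (by norm_num)
  rw [abs_sub_comm] at this
  rw [show (t₀ + t₁) / 2 = (1 - 1 / 2) * t₀ + 1 / 2 * t₁ by ring,
    show (g 0 t₁ + g 0 t₀) / 2 = (1 - 1 / 2) * g 0 t₀ + 1 / 2 * g 0 t₁ by ring]
  exact this

theorem abs_diff_le (hg : BoundedTimeJet T B g) (h0 : t₀ ∈ Set.Icc 0 T)
    (h1 : t₁ ∈ Set.Icc 0 T) (h01 : t₀ < t₁) : |(g 0 t₁ - g 0 t₀) / (t₁ - t₀)| ≤ B := by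
  have h2 : 0 < t₁ - t₀ := sub_pos.2 h01
  have k := hg.taylor (n := 1) (by omega) h0 h1
  simp at k
  rw [abs_div, div_le_iff₀ (abs_pos.2 h2.ne')]
  exact k

/-- Expansion about the midpoint: the quadratic terms at the two ends coincide and cancel, so the
remainder is cubic before division. -/
theorem abs_diff_sub_le (hg : BoundedTimeJet T B g) (h0 : t₀ ∈ Set.Icc 0 T)
    (h1 : t₁ ∈ Set.Icc 0 T) (h01 : t₀ < t₁) :
    |(g 0 t₁ - g 0 t₀) / (t₁ - t₀) - g 1 ((t₀ + t₁) / 2)| ≤ B * (t₁ - t₀) ^ 2 := by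
  have h2 : 0 < t₁ - t₀ := sub_pos.2 h01
  have hc : (t₀ + t₁) / 2 ∈ Set.Icc 0 T := ⟨by linarith [h0.1, h1.1], by linarith [h0.2, h1.2]⟩
  have hB : 0 ≤ B := (abs_nonneg _).trans (hg.bound 0 (by omega) _ hc)
  have k0 := hg.taylor (n := 3) (by omega) hc h0
  have k1 := hg.taylor (n := 3) (by omega) hc h1
  rw [show t₀ - (t₀ + t₁) / 2 = -((t₁ - t₀) / 2) by ring, abs_neg,
    abs_of_pos (by linarith : 0 < (t₁ - t₀) / 2)] at k0
  rw [show t₁ - (t₀ + t₁) / 2 = (t₁ - t₀) / 2 by ring,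
    abs_of_pos (by linarith : 0 < (t₁ - t₀) / 2)] at k1
  simp [Finset.sum_range_succ, abs_le] at k0 k1
  set c := (t₀ + t₁) / 2
  set δ := t₁ - t₀
  have hd : 0 ≤ B * δ ^ 3 := by positivity
  rw [show (g 0 t₁ - g 0 t₀) / δ - g 1 c = (g 0 t₁ - g 0 t₀ - δ * g 1 c) / δ by field_simp,
    abs_div, abs_of_pos h2, div_le_iff₀ h2, abs_le]
  constructor <;> linarith [k0.1, k0.2, k1.1, k1.2]

end BoundedTimeJet

/-! ### Consistency of the scheme -/

section Consistency

variable {μ lam L T B a h τ t₀ t₁ : ℝ} {u : ℝ → ℝ → ℝ}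

/-- `u` is smooth and periodic, with derivatives of order at most `6` in space and `3` in time
bounded by `B`. -/
structure BoundedSmoothPeriodic (L T B : ℝ) (u : ℝ → ℝ → ℝ) : Prop
    extends SmoothPeriodic L T u where
  pos : 0 < T
  bound : ∀ i ≤ 3, ∀ j ≤ 6, ∀ x, ∀ t ∈ Set.Icc (0 : ℝ) T, |BBMB.dtIter T i (BBMB.dx j u) x t| ≤ B

namespace BoundedSmoothPeriodic

theorem timeJet (hu : BoundedSmoothPeriodic L T B u) {j : ℕ} (hj : j ≤ 6) (x : ℝ) :
    BoundedTimeJet T B fun i t => BBMB.dtIter T i (BBMB.dx j u) x t :=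
  ⟨fun i _ _ ht => (hu.toSmoothPeriodic.dx hu.pos j).hasDerivWithinAt_dtIter hu.pos i ht,
    fun i hi t ht => hu.bound i hi j hj x t ht⟩

theorem jet (hu : BoundedSmoothPeriodic L T B u) {t : ℝ} (ht : t ∈ Set.Icc (0 : ℝ) T) :
    BoundedJet B fun j x => BBMB.dx j u x t :=
  ⟨fun j _ _ => hu.toSmoothPeriodic.hasDerivAt_dx hu.pos j ht,
    fun j hj x => hu.bound 0 (by omega) j hj x t ht⟩

/-- Time averages have bounded jets with the same `B`, so the spatial consistency estimates apply to
them directly, including the nonlinear one. `jet_diff` does the same for difference quotients, at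
the price of one time derivative and without a factor `1/τ`. -/
theorem jet_avg (hu : BoundedSmoothPeriodic L T B u) (h0 : t₀ ∈ Set.Icc (0 : ℝ) T)
    (h1 : t₁ ∈ Set.Icc (0 : ℝ) T) :
    BoundedJet B fun j x => (BBMB.dx j u x t₁ + BBMB.dx j u x t₀) / 2 := by
  refine ⟨fun j hj x => ((hu.jet h1).deriv j hj x).add ((hu.jet h0).deriv j hj x) |>.div_const 2,
    fun j hj x => ?_⟩
  have b0 := abs_le.1 ((hu.jet h0).bound j hj x)
  have b1 := abs_le.1 ((hu.jet h1).bound j hj x)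
  rw [abs_le]
  constructor <;> linarith [b0.1, b0.2, b1.1, b1.2]

theorem jet_diff (hu : BoundedSmoothPeriodic L T B u) (h0 : t₀ ∈ Set.Icc (0 : ℝ) T)
    (h1 : t₁ ∈ Set.Icc (0 : ℝ) T) (h01 : t₀ < t₁) :
    BoundedJet B fun j x => (BBMB.dx j u x t₁ - BBMB.dx j u x t₀) / (t₁ - t₀) :=
  ⟨fun j hj x => ((hu.jet h1).deriv j hj x).sub ((hu.jet h0).deriv j hj x) |>.div_const _,
    fun _ hj x => (hu.timeJet hj x).abs_diff_le h0 h1 h01⟩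

theorem isPeriodicGrid_restrict {F : ℝ → ℝ → ℝ} (hF : SmoothPeriodic L T F) {M l : ℕ}
    (hMh : M * h = L) (hl : (l : ℝ) * τ ∈ Set.Icc (0 : ℝ) T) :
    IsPeriodicGrid M (restrict a h τ F l) := by
  intro p
  simp only [restrict]
  rw [← hF.periodic (a + p * h) _ hl, ← hMh]
  push_cast
  ring_nf

/-- For grid values of a smooth function the second difference is bounded by `2B`, so the maximum
principle gives a bound uniform in `h`. -/
theorem abs_compact_right_le (hu : BoundedSmoothPeriodic L T B u) {M l : ℕ} (hM : 0 < M)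
    (hh : 0 < h) (hl : (l : ℝ) * τ ∈ Set.Icc (0 : ℝ) T) {w : ℤ → ℝ}
    (hw : CompactPair M h (restrict a h τ u l) w) (p : ℤ) : |w p| ≤ 3 * B := by
  have := abs_le_of_abs_compactOp_le hM hh hw.periodic_right (c := 2 * B) (fun q => by
    rw [hw.compactOp_right]
    have := (hu.jet hl).abs_deltaXX_le (a := a) hh q
    simp only [dx_zero] at this
    exact this) p
  linarith

end BoundedSmoothPeriodic

/-- A crude inverse bound. The loss of `1/h` is harmless because it is applied to the defect of the
compact second difference, where the scheme carries a factor `h²`. -/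
theorem abs_centralDiff_le_of_abs_le {c : ℝ} (hh : 0 < h) {v : ℤ → ℝ} (hv : ∀ p, |v p| ≤ c)
    (p : ℤ) : |centralDiff h v p| ≤ c / h := by
  have h1 := abs_le.1 (hv (p + 1))
  have h2 := abs_le.1 (hv (p - 1))
  rw [centralDiff, abs_div, abs_of_pos (by positivity : 0 < 2 * h), div_le_div_iff₀ (by positivity)
    hh]
  have : |v (p + 1) - v (p - 1)| ≤ 2 * c := by
    rw [abs_le]; constructor <;> linarith [h1.1, h1.2, h2.1, h2.2]
  nlinarith

theorem abs_psi_le {c : ℝ} (hh : 0 < h) {v w : ℤ → ℝ} (hv : ∀ p, |v p| ≤ c)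
    (hw : ∀ p, |w p| ≤ B) (hdw : ∀ p, |centralDiff h w p| ≤ B) (p : ℤ) :
    |psi h v w p| ≤ (c * B + c * B / h) / 3 := by
  have hc : 0 ≤ c := (abs_nonneg _).trans (hv 0)
  rw [psi, abs_div, abs_of_pos (by norm_num : (0 : ℝ) < 3)]
  gcongr
  refine (abs_add_le _ _).trans (add_le_add ?_ ?_)
  · rw [abs_mul]; exact mul_le_mul (hv p) (hdw p) (abs_nonneg _) hc
  · refine abs_centralDiff_le_of_abs_le hh (fun q => ?_) p
    rw [abs_mul]; exact mul_le_mul (hv q) (hw q) (abs_nonneg _) hc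

/-- The truncation error of the scheme, for the exact second derivative in place of the compact
second difference. -/
theorem abs_schemeLHS_exact_le (hμ : 0 ≤ μ) (hlam : 0 ≤ lam)
    (hu : BoundedSmoothPeriodic L T B u)
    (pde : ∀ x : ℝ, ∀ t ∈ Set.Ioc (0 : ℝ) T,
      dt T u x t - μ * dt T (dx 2 u) x t + u x t * dx 1 u x t + dx 1 u x t - lam * dx 2 u x t = 0)
    (hh : 0 < h) (hτ : 0 < τ) {l : ℕ} (hl : ((l + 1 : ℕ) : ℝ) * τ ≤ T) (p : ℤ) :
    |schemeLHS μ lam τ h (restrict a h τ u) (restrict a h τ (dx 2 u)) (restrict a h τ u)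
        (restrict a h τ (dx 2 u)) l p|
      ≤ (2 * B + μ * B + lam * B + 2 * B ^ 2) * τ ^ 2 + (3 * B ^ 2 + 2 * B) * h ^ 4 := by
  set t₀ := (l : ℝ) * τ with ht₀
  set t₁ := ((l + 1 : ℕ) : ℝ) * τ with ht₁
  have hd : t₁ - t₀ = τ := by rw [ht₀, ht₁]; push_cast; ring
  have h00 : 0 ≤ t₀ := by positivity
  have h0 : t₀ ∈ Set.Icc 0 T := ⟨h00, by linarith⟩
  have h1 : t₁ ∈ Set.Icc 0 T := ⟨by linarith, hl⟩
  have hm : (t₀ + t₁) / 2 ∈ Set.Ioc 0 T := ⟨by linarith, by linarith⟩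
  have hm' := Set.Ioc_subset_Icc_self hm
  set x := a + p * h with hx
  have hf := hu.jet_avg h0 h1
  have a1 := hf.abs_psi_sub_le (a := a) hh p
  have a2 := hf.abs_centralDiff_sub_le (a := a) hh p
  have b0 := (hu.timeJet (j := 0) (by omega) x).abs_avg_sub_le h0 h1
  have b1 := (hu.timeJet (j := 1) (by omega) x).abs_avg_sub_le h0 h1
  have b2 := (hu.timeJet (j := 2) (by omega) x).abs_avg_sub_le h0 h1
  have d0 := (hu.timeJet (j := 0) (by omega) x).abs_diff_sub_le h0 h1 (by linarith)
  have d2 := (hu.timeJet (j := 2) (by omega) x).abs_diff_sub_le h0 h1 (by linarith)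
  have c1 := hf.bound 1 (by omega) x
  have c0 := hu.bound 0 (by omega) 0 (by omega) x _ hm'
  have hpde := pde x _ hm
  rw [hd] at b0 b1 b2 d0 d2
  simp only [dx_zero, dtIter, Function.iterate_zero, id, Function.iterate_one]
    at a1 a2 b0 b1 b2 d0 d2 c1 c0
  rw [← hx] at a1 a2
  set tm := (t₀ + t₁) / 2
  have e : schemeLHS μ lam τ h (restrict a h τ u) (restrict a h τ (dx 2 u)) (restrict a h τ u)
        (restrict a h τ (dx 2 u)) l p
      = (u x t₁ - u x t₀) / τ - μ * ((dx 2 u x t₁ - dx 2 u x t₀) / τ)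
        + (psi h (sample a h fun x => (u x t₁ + u x t₀) / 2)
            (sample a h fun x => (u x t₁ + u x t₀) / 2) p
          - h ^ 2 / 2 * psi h (sample a h fun x => (dx 2 u x t₁ + dx 2 u x t₀) / 2)
            (sample a h fun x => (u x t₁ + u x t₀) / 2) p)
        + (centralDiff h (sample a h fun x => (u x t₁ + u x t₀) / 2) p
          - h ^ 2 / 6 * centralDiff h (sample a h fun x => (dx 2 u x t₁ + dx 2 u x t₀) / 2) p)
        - lam * ((dx 2 u x t₁ + dx 2 u x t₀) / 2) := by
    have e1 : timeAvg (restrict a h τ u) l = sample a h fun x => (u x t₁ + u x t₀) / 2 := rfl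
    have e2 : timeAvg (restrict a h τ (dx 2 u)) l
        = sample a h fun x => (dx 2 u x t₁ + dx 2 u x t₀) / 2 := rfl
    rw [schemeLHS, e1, e2]
    simp only [timeDiff, restrict, sample]
    ring
  -- The product of averages is compared with the product at the midpoint, where the differential
  -- equation holds, one factor at a time.
  have m1 : |((u x t₁ + u x t₀) / 2 - u x tm) * ((dx 1 u x t₁ + dx 1 u x t₀) / 2)|
      ≤ B * τ ^ 2 * B := by
    rw [abs_mul]; gcongr; exact (abs_nonneg _).trans b0
  have m2 : |u x tm * ((dx 1 u x t₁ + dx 1 u x t₀) / 2 - dx 1 u x tm)| ≤ B * (B * τ ^ 2) := by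
    rw [abs_mul]; gcongr; exact (abs_nonneg _).trans c0
  have m3 : |μ * ((dx 2 u x t₁ - dx 2 u x t₀) / τ - dt T (dx 2 u) x tm)| ≤ μ * (B * τ ^ 2) := by
    rw [abs_mul, abs_of_nonneg hμ]; gcongr
  have m4 : |lam * ((dx 2 u x t₁ + dx 2 u x t₀) / 2 - dx 2 u x tm)| ≤ lam * (B * τ ^ 2) := by
    rw [abs_mul, abs_of_nonneg hlam]; gcongr
  rw [e]
  rw [abs_le] at *
  constructor <;>
    linarith [a1.1, a1.2, a2.1, a2.2, b1.1, b1.2, d0.1, d0.2, m1.1, m1.2, m2.1, m2.2, m3.1, m3.2,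
      m4.1, m4.2]

/-- The truncation error of the scheme. -/
theorem abs_schemeLHS_le (hμ : 0 ≤ μ) (hlam : 0 ≤ lam)
    (hu : BoundedSmoothPeriodic L T B u)
    (pde : ∀ x : ℝ, ∀ t ∈ Set.Ioc (0 : ℝ) T,
      dt T u x t - μ * dt T (dx 2 u) x t + u x t * dx 1 u x t + dx 1 u x t - lam * dx 2 u x t = 0)
    {M : ℕ} (hM : 0 < M) (hh : 0 < h) (hMh : M * h = L)
    (hτ : 0 < τ) {l : ℕ} (hl : ((l + 1 : ℕ) : ℝ) * τ ≤ T) {w : ℕ → ℤ → ℝ}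
    (hw0 : CompactPair M h (restrict a h τ u l) (w l))
    (hw1 : CompactPair M h (restrict a h τ u (l + 1)) (w (l + 1))) (p : ℤ) :
    |schemeLHS μ lam τ h (restrict a h τ u) w (restrict a h τ u) w l p|
      ≤ (4 * B + 6 * μ * B + 6 * lam * B + 6 * B ^ 2 + (L + L ^ 2) * B ^ 2 + L * B)
        * (τ ^ 2 + h ^ 4) := by
  have ht : (l : ℝ) * τ ≤ T := le_trans (by gcongr; simp) hl
  have h0 : (l : ℝ) * τ ∈ Set.Icc 0 T := ⟨by positivity, ht⟩
  have h1 : ((l + 1 : ℕ) : ℝ) * τ ∈ Set.Icc 0 T := ⟨by positivity, hl⟩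
  have hd : ((l + 1 : ℕ) : ℝ) * τ - (l : ℝ) * τ = τ := by push_cast; ring
  have hB := (hu.jet h0).nonneg
  have hhL : h ≤ L := by
    rw [← hMh]; exact le_mul_of_one_le_left hh.le (by exact_mod_cast hM)
  set U := restrict a h τ u with hU
  set W := restrict a h τ (dx 2 u) with hW
  -- The maximum principle converts the consistency error `3 B h⁴` of the implicit relation into a
  -- pointwise distance between `f''` and the compact second difference, hence `9/2 = (3/2)·3`. It
  -- is applied to time averages and to time difference quotients.
  have hD : ∀ (f : ℕ → ℝ → ℝ), BoundedJet B f → ∀ w' : ℤ → ℝ,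
      CompactPair M h (sample a h (f 0)) w' → IsPeriodicGrid M (sample a h (f 2)) →
      ∀ q, |sample a h (f 2) q - w' q| ≤ 9 / 2 * B * h ^ 4 := by
    intro f hf w' hp hper q
    have := abs_le_of_abs_compactOp_le hM hh (hper.sub hp.periodic_right) (c := 3 * B * h ^ 4)
      (fun q => by
        have e : compactOp h (sample a h (f 2) - w') q
            = compactOp h (sample a h (f 2)) q - compactOp h w' q := by
          simp only [compactOp, deltaXX_eq, Pi.sub_apply]; ring
        rw [e, hp.compactOp_right]
        exact hf.abs_compactOp_sub_deltaXX_le hh q) q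
    simp only [Pi.sub_apply] at this
    linarith
  have pW0 : IsPeriodicGrid M (W l) :=
    BoundedSmoothPeriodic.isPeriodicGrid_restrict (hu.toSmoothPeriodic.dx hu.pos 2) hMh h0
  have pW1 : IsPeriodicGrid M (W (l + 1)) :=
    BoundedSmoothPeriodic.isPeriodicGrid_restrict (hu.toSmoothPeriodic.dx hu.pos 2) hMh h1
  have havg := hu.jet_avg h0 h1
  have hdiff := hu.jet_diff h0 h1 (by linarith)
  have kavg : ∀ q, |timeAvg W l q - timeAvg w l q| ≤ 9 / 2 * B * h ^ 4 := by
    refine hD _ havg (timeAvg w l) ?_ (pW0.timeAvg pW1)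
    simp only [dx_zero]
    exact hw0.timeAvg hw1
  have kdiff : ∀ q, |timeDiff τ W l q - timeDiff τ w l q| ≤ 9 / 2 * B * h ^ 4 := by
    have ed : ∀ v : ℕ → ℤ → ℝ, timeDiff τ v l = τ⁻¹ • (v (l + 1) - v l) := by
      intro v; ext q; simp only [timeDiff, Pi.smul_apply, Pi.sub_apply, smul_eq_mul]; ring
    have es : ∀ F : ℝ → ℝ → ℝ, timeDiff τ (restrict a h τ F) l
        = sample a h fun x => (F x (((l + 1 : ℕ) : ℝ) * τ) - F x (l * τ))
          / (((l + 1 : ℕ) : ℝ) * τ - (l : ℝ) * τ) := by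
      intro F; ext q; rw [hd]; rfl
    have := hD _ hdiff (timeDiff τ w l) (by
      simp only [dx_zero]
      rw [← es u, ed, ed]
      exact (hw1.sub hw0).smul _) (by
      rw [← es (dx 2 u), ed]
      exact (pW1.sub pW0).smul _)
    rw [← es (dx 2 u)] at this
    exact this
  have kex := abs_schemeLHS_exact_le (a := a) hμ hlam hu pde hh hτ hl p
  rw [← hU, ← hW] at kex
  have kψ := abs_psi_le hh (B := B) (v := fun q => timeAvg W l q - timeAvg w l q)
    (w := timeAvg U l) kavg (fun q => by
      have := havg.bound 0 (by omega) (a + q * h)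
      simp only [dx_zero] at this
      exact this) (fun q => by
      have := havg.abs_centralDiff_le hh (a := a) (i := 0) (by omega) q
      simp only [dx_zero] at this
      exact this) p
  have kΔ := abs_centralDiff_le_of_abs_le hh kavg p
  have e : schemeLHS μ lam τ h U w U w l p = schemeLHS μ lam τ h U W U W l p
      + μ * (timeDiff τ W l p - timeDiff τ w l p)
      + h ^ 2 / 2 * psi h (fun q => timeAvg W l q - timeAvg w l q) (timeAvg U l) p
      + h ^ 2 / 6 * centralDiff h (fun q => timeAvg W l q - timeAvg w l q) p
      + lam * (timeAvg W l p - timeAvg w l p) := by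
    simp only [schemeLHS, psi, centralDiff]
    ring
  have m1 : |μ * (timeDiff τ W l p - timeDiff τ w l p)| ≤ μ * (9 / 2 * B * h ^ 4) := by
    rw [abs_mul, abs_of_nonneg hμ]; exact mul_le_mul_of_nonneg_left (kdiff p) hμ
  have m2 : |lam * (timeAvg W l p - timeAvg w l p)| ≤ lam * (9 / 2 * B * h ^ 4) := by
    rw [abs_mul, abs_of_nonneg hlam]; exact mul_le_mul_of_nonneg_left (kavg p) hlam
  have m3 : |h ^ 2 / 2 * psi h (fun q => timeAvg W l q - timeAvg w l q) (timeAvg U l) p|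
      ≤ (L + L ^ 2) * B ^ 2 * h ^ 4 := by
    rw [abs_mul, abs_of_nonneg (by positivity : 0 ≤ h ^ 2 / 2)]
    refine (mul_le_mul_of_nonneg_left kψ (by positivity)).trans ?_
    rw [show h ^ 2 / 2 * ((9 / 2 * B * h ^ 4 * B + 9 / 2 * B * h ^ 4 * B / h) / 3)
      = 3 / 4 * (h + h ^ 2) * B ^ 2 * h ^ 4 by field_simp; ring]
    have : 3 / 4 * (h + h ^ 2) ≤ L + L ^ 2 := by nlinarith
    gcongr
  have m4 : |h ^ 2 / 6 * centralDiff h (fun q => timeAvg W l q - timeAvg w l q) p|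
      ≤ L * B * h ^ 4 := by
    rw [abs_mul, abs_of_nonneg (by positivity : 0 ≤ h ^ 2 / 6)]
    refine (mul_le_mul_of_nonneg_left kΔ (by positivity)).trans ?_
    rw [show h ^ 2 / 6 * (9 / 2 * B * h ^ 4 / h) = 3 / 4 * h * B * h ^ 4 by field_simp; ring]
    have : 3 / 4 * h ≤ L := by linarith
    gcongr
  rw [e]
  have hL : 0 < L := lt_of_lt_of_le hh hhL
  have s0 : 0 ≤ B * τ ^ 2 := by positivity
  have s1 : 0 ≤ B * h ^ 4 := by positivity
  have s2 : 0 ≤ B ^ 2 * τ ^ 2 := by positivity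
  have s3 : 0 ≤ B ^ 2 * h ^ 4 := by positivity
  have s4 : 0 ≤ μ * (B * τ ^ 2) := by positivity
  have s5 : 0 ≤ lam * (B * τ ^ 2) := by positivity
  have s6 : 0 ≤ μ * (B * h ^ 4) := by positivity
  have s7 : 0 ≤ lam * (B * h ^ 4) := by positivity
  have s8 : 0 ≤ (L + L ^ 2) * B ^ 2 * τ ^ 2 := by positivity
  have s9 : 0 ≤ L * B * τ ^ 2 := by positivity
  rw [abs_le] at *
  constructor <;>
    linarith [kex.1, kex.2, m1.1, m1.2, m2.1, m2.2, m3.1, m3.2, m4.1, m4.2]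

end Consistency

/-! ### Stability and convergence of the scheme -/

/-- A bound for the energy of the initial values and of the exact solution. -/
def energyConst (μ L B : ℝ) : ℝ := L * (B ^ 2 + 3 * μ * B ^ 2)

/-- The constant in the bound for the truncation error. -/
def truncConst (μ lam L B : ℝ) : ℝ :=
  4 * B + 6 * μ * B + 6 * lam * B + 6 * B ^ 2 + (L + L ^ 2) * B ^ 2 + L * B

/-- The growth rate of the energy of the error for a given first argument of `Ψ`. -/
def growthConst (μ B : ℝ) : ℝ := 1 / 2 + B / 3 + B / (3 * μ)

section Convergence

variable {μ lam L T B a h τ : ℝ} {M N : ℕ} {φ : ℝ → ℝ} {u : ℝ → ℝ → ℝ}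
  {v z uh wh Wt : ℕ → ℤ → ℝ}

theorem energy_le_energyConst (hμ : 0 ≤ μ) (hh : 0 < h) (hMh : M * h = L) {v w : ℤ → ℝ}
    (hv : ∀ p, |v p| ≤ B) (hw : ∀ p, |w p| ≤ 3 * B) : energy μ M h v w ≤ energyConst μ L B := by
  have hB : 0 ≤ B := (abs_nonneg _).trans (hv 0)
  have h1 : ∀ p ∈ Finset.Icc (1 : ℤ) M, v p ^ 2 - μ * (w p * v p) ≤ B ^ 2 + 3 * μ * B ^ 2 := by
    intro p _
    have a1 : v p ^ 2 ≤ B ^ 2 := sq_le_sq' (abs_le.1 (hv p)).1 (abs_le.1 (hv p)).2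
    have a2 : |w p * v p| ≤ 3 * B * B := by
      rw [abs_mul]; exact mul_le_mul (hw p) (hv p) (abs_nonneg _) (by positivity)
    have a3 := mul_le_mul_of_nonneg_left (neg_le_of_abs_le a2) hμ
    linarith
  have h2 := mul_le_mul_of_nonneg_left (Finset.sum_le_sum h1) hh.le
  rw [Finset.sum_const, nsmul_eq_mul] at h2
  simp only [Int.card_Icc, add_sub_cancel_right, Int.toNat_natCast] at h2
  rw [energy, energyConst, ← hMh]
  linarith

theorem SolvesScheme.compactPair (hs : SolvesScheme μ lam a τ h M N φ v z uh wh) (hM : 0 < M)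
    (hh : 0 < h) {l : ℕ} (hl : l ≤ N) : CompactPair M h (uh l) (wh l) :=
  .of_compactRelation hM hh (hs.periodic_u l hl) (hs.periodic_w l hl) (hs.compact l hl)

theorem mul_mem_Icc (hτ : 0 < τ) (hN : N * τ = T) {l : ℕ} (hl : l ≤ N) :
    (l : ℝ) * τ ∈ Set.Icc 0 T := by
  refine ⟨by positivity, ?_⟩
  rw [← hN]
  gcongr

theorem SolvesScheme.initial_eq (hs : SolvesScheme μ lam a τ h M N φ v z uh wh) (hM : 0 < M)
    (hu : BoundedSmoothPeriodic L T B u) (hφ : ∀ x, u x 0 = φ x) (hMh : M * h = L)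
    (p : ℤ) : uh 0 p = restrict a h τ u 0 p := by
  refine IsPeriodicGrid.forall_of_forall_mem hM (hs.periodic_u 0 (Nat.zero_le _))
    (BoundedSmoothPeriodic.isPeriodicGrid_restrict hu.toSmoothPeriodic hMh
      (by simpa using hu.pos.le)) (fun q hq => ?_) p
  rw [hs.initial q hq, restrict, ← hφ]
  simp

theorem BoundedSmoothPeriodic.abs_restrict_le (hu : BoundedSmoothPeriodic L T B u) {l : ℕ}
    (hl : (l : ℝ) * τ ∈ Set.Icc 0 T) (p : ℤ) : |restrict a h τ u l p| ≤ B := by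
  have := hu.bound 0 (by omega) 0 (by omega) (a + p * h) _ hl
  rw [dx_zero] at this
  exact this

theorem BoundedSmoothPeriodic.energy_le (hμ : 0 ≤ μ) (hu : BoundedSmoothPeriodic L T B u)
    (hM : 0 < M) (hh : 0 < h) (hMh : M * h = L) {l : ℕ} (hl : (l : ℝ) * τ ∈ Set.Icc 0 T)
    {w : ℤ → ℝ} (hw : CompactPair M h (restrict a h τ u l) w) :
    energy μ M h (restrict a h τ u l) w ≤ energyConst μ L B :=
  energy_le_energyConst hμ hh hMh (hu.abs_restrict_le hl) (hu.abs_compact_right_le hM hh hl hw)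

/-- Unconditional stability of the scheme. -/
theorem SolvesScheme.energy_le (hs : SolvesScheme μ lam a τ h M N φ v z uh wh) (hμ : 0 ≤ μ)
    (hlam : 0 ≤ lam) (hM : 0 < M) (hh : 0 < h) (hτ : 0 < τ)
    (hu : BoundedSmoothPeriodic L T B u) (hφ : ∀ x, u x 0 = φ x) (hMh : M * h = L)
    (hvz : ∀ l ≤ N, CompactPair M h (v l) (z l)) :
    ∀ l ≤ N, energy μ M h (uh l) (wh l) ≤ energyConst μ L B := by
  intro l
  induction l with
  | zero =>
    intro hl
    have hp := hs.compactPair hM hh hl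
    have e : uh 0 = restrict a h τ u 0 := funext (hs.initial_eq hM hu hφ hMh)
    rw [e] at hp ⊢
    exact hu.energy_le hμ hM hh hMh (by simpa using hu.pos.le) hp
  | succ l ih =>
    intro hl
    have hp := (hvz l (by omega)).timeAvg (hvz (l + 1) hl)
    have := energy_succ_le (μ := μ) (lam := lam) hlam hτ hh hp.periodic_left hp.periodic_right
      (hs.compactPair hM hh (by omega : l ≤ N)) (hs.compactPair hM hh hl)
    rw [Finset.sum_eq_zero fun p hp' => by
      rw [hs.eqn l (by omega) p (by simpa using hp'), zero_mul]] at this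
    linarith [ih (by omega)]

/-- The energy recursion of the error. -/
theorem SolvesScheme.energy_error_step (hs : SolvesScheme μ lam a τ h M N φ v z uh wh)
    (hμ : 0 < μ) (hlam : 0 ≤ lam) (hM : 0 < M) (hh : 0 < h) (hτ : 0 < τ)
    (hu : BoundedSmoothPeriodic L T B u)
    (pde : ∀ x : ℝ, ∀ t ∈ Set.Ioc (0 : ℝ) T,
      dt T u x t - μ * dt T (dx 2 u) x t + u x t * dx 1 u x t + dx 1 u x t - lam * dx 2 u x t = 0)
    (hMh : M * h = L) (hN : N * τ = T)
    (hvz : ∀ l ≤ N, CompactPair M h (v l) (z l))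
    (hWt : ∀ l ≤ N, CompactPair M h (restrict a h τ u l) (Wt l)) {n : ℕ} (hn : n < N) :
    energy μ M h (restrict a h τ u (n + 1) - uh (n + 1)) (Wt (n + 1) - wh (n + 1))
        - energy μ M h (restrict a h τ u n - uh n) (Wt n - wh n)
      ≤ τ * (growthConst μ B
          * (energy μ M h (restrict a h τ u (n + 1) - uh (n + 1)) (Wt (n + 1) - wh (n + 1))
            + energy μ M h (restrict a h τ u n - uh n) (Wt n - wh n))
        + (L * (truncConst μ lam L B * (τ ^ 2 + h ^ 4)) ^ 2
          + 20 * B / 3 * (h * ∑ p ∈ Finset.Icc (1 : ℤ) M,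
            (timeAvg (restrict a h τ u - v) n p) ^ 2))) := by
  set U := restrict a h τ u with hU
  have hl1 := mul_mem_Icc hτ hN (Nat.succ_le_of_lt hn)
  have hl0 := mul_mem_Icc hτ hN hn.le
  have havg := hu.jet_avg hl0 hl1
  have hB := havg.nonneg
  have hUp : IsPeriodicGrid M (timeAvg U n) :=
    (hWt n hn.le).periodic_left.timeAvg (hWt (n + 1) hn).periodic_left
  have p0 : CompactPair M h (U n - uh n) (Wt n - wh n) :=
    (hWt n hn.le).sub (hs.compactPair hM hh hn.le)
  have p1 : CompactPair M h (U (n + 1) - uh (n + 1)) (Wt (n + 1) - wh (n + 1)) :=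
    (hWt (n + 1) hn).sub (hs.compactPair hM hh hn)
  have q0 : CompactPair M h (U n - v n) (Wt n - z n) := (hWt n hn.le).sub (hvz n hn.le)
  have q1 : CompactPair M h (U (n + 1) - v (n + 1)) (Wt (n + 1) - z (n + 1)) :=
    (hWt (n + 1) hn).sub (hvz (n + 1) hn)
  have hvp := (hvz n hn.le).timeAvg (hvz (n + 1) hn)
  have hR : ∀ p, |schemeLHS μ lam τ h U Wt U Wt n p|
      ≤ truncConst μ lam L B * (τ ^ 2 + h ^ 4) := fun p =>
    abs_schemeLHS_le hμ.le hlam hu pde hM hh hMh hτ hl1.2 (hWt n hn.le) (hWt (n + 1) hn) p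
  have key := energy_error_succ_le (e := U - uh) (r := Wt - wh) (l := n) (v := v) (z := z)
    (ε := timeAvg (U - v) n) (ζ := timeAvg (Wt - z) n) (U := timeAvg U n)
    (R := schemeLHS μ lam τ h U Wt U Wt n) (lam := lam)
    hB hμ hlam hτ hh hvp.periodic_left hvp.periodic_right p0 p1
    (CompactPair.timeAvg (v := U - v) (w := Wt - z) q0 q1) hUp
    (fun q => by
      have := havg.bound 0 (by omega) (a + q * h)
      simp only [dx_zero] at this
      exact this)
    (fun q => by
      have := havg.abs_centralDiff_le hh (a := a) (i := 0) (by omega) q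
      simp only [dx_zero] at this
      exact this)
    (fun p hp => by
      have h0 := hs.eqn n hn p hp
      -- Bilinearity, in the form `Ψ(v, U - u) = Ψ(U,U) - Ψ(U - v, U) - Ψ(v,u)`, applied to time
      -- averages and likewise with `z` and `Wt`.
      have e : schemeLHS μ lam τ h v z (U - uh) (Wt - wh) n p
          = schemeLHS μ lam τ h U Wt U Wt n p - psi h (timeAvg (U - v) n) (timeAvg U n) p
            + h ^ 2 / 2 * psi h (timeAvg (Wt - z) n) (timeAvg U n) p
            - schemeLHS μ lam τ h v z uh wh n p := by
        simp only [schemeLHS, psi, centralDiff, timeAvg, timeDiff, Pi.sub_apply]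
        ring
      rw [e, h0, sub_zero])
  have hsum : h * ∑ p ∈ Finset.Icc (1 : ℤ) M, schemeLHS μ lam τ h U Wt U Wt n p ^ 2
      ≤ L * (truncConst μ lam L B * (τ ^ 2 + h ^ 4)) ^ 2 := by
    have h2 := mul_le_mul_of_nonneg_left (Finset.sum_le_sum fun p (_ : p ∈ Finset.Icc (1 : ℤ) M) =>
      sq_le_sq' (abs_le.1 (hR p)).1 (abs_le.1 (hR p)).2) hh.le
    rw [Finset.sum_const, nsmul_eq_mul] at h2
    simp only [Int.card_Icc, add_sub_cancel_right, Int.toNat_natCast] at h2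
    refine h2.trans_eq ?_
    rw [← hMh]; ring
  simp only [Pi.sub_apply] at key
  refine key.trans ?_
  rw [growthConst]
  gcongr

/-- Gronwall's inequality for small time steps, and stability for large ones. -/
theorem SolvesScheme.energy_error_le_of_step (hs : SolvesScheme μ lam a τ h M N φ v z uh wh)
    (hμ : 0 < μ) (hlam : 0 ≤ lam) (hM : 0 < M) (hh : 0 < h) (hτ : 0 < τ)
    (hu : BoundedSmoothPeriodic L T B u) (hφ : ∀ x, u x 0 = φ x)
    (hMh : M * h = L) (hN : N * τ = T)
    (hvz : ∀ l ≤ N, CompactPair M h (v l) (z l))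
    (hWt : ∀ l ≤ N, CompactPair M h (restrict a h τ u l) (Wt l)) {K F : ℝ} (hK : 0 ≤ K)
    (hF : 0 ≤ F)
    (hstep : ∀ n < N,
      energy μ M h (restrict a h τ u (n + 1) - uh (n + 1)) (Wt (n + 1) - wh (n + 1))
        - energy μ M h (restrict a h τ u n - uh n) (Wt n - wh n)
      ≤ τ * (K * (energy μ M h (restrict a h τ u (n + 1) - uh (n + 1)) (Wt (n + 1) - wh (n + 1))
        + energy μ M h (restrict a h τ u n - uh n) (Wt n - wh n)) + F)) :
    ∀ n ≤ N, energy μ M h (restrict a h τ u n - uh n) (Wt n - wh n)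
      ≤ 2 * T * Real.exp (4 * K * T) * F + 4 * energyConst μ L B * (2 * K) ^ 4 * τ ^ 4 := by
  intro n hn
  have hT := hu.pos
  have hS : 0 ≤ energyConst μ L B :=
    ((hs.compactPair hM hh (Nat.zero_le N)).energy_nonneg hμ.le hh).trans
      (hs.energy_le hμ.le hlam hM hh hτ hu hφ hMh hvz 0 (Nat.zero_le N))
  rcases le_or_gt (τ * K) (1 / 2) with hτK | hτK
  · have := discrete_gronwall
      (x := fun n => energy μ M h (restrict a h τ u n - uh n) (Wt n - wh n)) hτ.le hK hF hτK hN.le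
      (fun n hn => ((hWt n hn).sub (hs.compactPair hM hh hn)).energy_nonneg hμ.le hh) (by
        have e : restrict a h τ u 0 - uh 0 = 0 := by
          ext p; simp [hs.initial_eq hM hu hφ hMh p]
        simp only [e]
        simp [energy]) hstep n hn
    refine this.trans (le_add_of_nonneg_right (by positivity))
  · have h1 := energy_sub_le hμ.le hh (hWt n hn) (hs.compactPair hM hh hn)
    have h2 := hu.energy_le hμ.le hM hh hMh (mul_mem_Icc hτ hN hn) (hWt n hn)
    have h3 := hs.energy_le hμ.le hlam hM hh hτ hu hφ hMh hvz n hn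
    -- When `τK > 1/2` the bounded energy of the error is already of size `τ⁴`, so no restriction on
    -- the time step is required.
    have h4 : 1 ≤ (2 * K * τ) ^ 4 := one_le_pow₀ (by linarith)
    have h5 : 4 * energyConst μ L B ≤ 4 * energyConst μ L B * (2 * K) ^ 4 * τ ^ 4 := by
      rw [mul_assoc, ← mul_pow]
      exact le_mul_of_one_le_right (by positivity) h4
    have h6 : 0 ≤ 2 * T * Real.exp (4 * K * T) * F := by positivity
    linarith

theorem sum_timeAvg_sq_le {e : ℕ → ℤ → ℝ} {n : ℕ} {G : ℝ} (hh : 0 < h)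
    (h0 : h * ∑ p ∈ Finset.Icc (1 : ℤ) M, e n p ^ 2 ≤ G)
    (h1 : h * ∑ p ∈ Finset.Icc (1 : ℤ) M, e (n + 1) p ^ 2 ≤ G) :
    h * ∑ p ∈ Finset.Icc (1 : ℤ) M, timeAvg e n p ^ 2 ≤ G := by
  have : ∑ p ∈ Finset.Icc (1 : ℤ) M, timeAvg e n p ^ 2
      ≤ ∑ p ∈ Finset.Icc (1 : ℤ) M, (1 / 2 * e (n + 1) p ^ 2 + 1 / 2 * e n p ^ 2) :=
    Finset.sum_le_sum fun p _ => by
      rw [timeAvg]; nlinarith [sq_nonneg (e (n + 1) p - e n p)]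
  rw [Finset.sum_add_distrib, ← Finset.mul_sum, ← Finset.mul_sum] at this
  have := mul_le_mul_of_nonneg_left this hh.le
  linarith

/-- Convergence of the nonlinear scheme. -/
theorem SolvesScheme.energy_error_le_nonlinear
    (hs : SolvesScheme μ lam a τ h M N φ uh wh uh wh)
    (hμ : 0 < μ) (hlam : 0 ≤ lam) (hM : 0 < M) (hh : 0 < h) (hτ : 0 < τ) (hB : 0 ≤ B)
    (hu : BoundedSmoothPeriodic L T B u) (hφ : ∀ x, u x 0 = φ x)
    (pde : ∀ x : ℝ, ∀ t ∈ Set.Ioc (0 : ℝ) T,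
      dt T u x t - μ * dt T (dx 2 u) x t + u x t * dx 1 u x t + dx 1 u x t - lam * dx 2 u x t = 0)
    (hMh : M * h = L) (hN : N * τ = T)
    (hWt : ∀ l ≤ N, CompactPair M h (restrict a h τ u l) (Wt l)) :
    ∀ n ≤ N, energy μ M h (restrict a h τ u n - uh n) (Wt n - wh n)
      ≤ (2 * T * Real.exp (4 * (growthConst μ B + 10 * B / 3) * T)
          * (L * truncConst μ lam L B ^ 2)
        + 4 * energyConst μ L B * (2 * (growthConst μ B + 10 * B / 3)) ^ 4)
        * (τ ^ 2 + h ^ 4) ^ 2 := by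
  intro n hn
  have hL : 0 ≤ L := by rw [← hMh]; positivity
  have hp : ∀ l ≤ N, CompactPair M h (uh l) (wh l) := fun l hl => hs.compactPair hM hh hl
  have hK : 0 ≤ growthConst μ B + 10 * B / 3 := by rw [growthConst]; positivity
  have hF : 0 ≤ L * (truncConst μ lam L B * (τ ^ 2 + h ^ 4)) ^ 2 := by positivity
  have hS : 0 ≤ energyConst μ L B := by rw [energyConst]; positivity
  refine (hs.energy_error_le_of_step hμ hlam hM hh hτ hu hφ hMh hN hp hWt hK hF
    (fun n hn => ?_) n hn).trans ?_
  · refine (hs.energy_error_step hμ hlam hM hh hτ hu pde hMh hN hp hWt hn).trans ?_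
    have p0 : CompactPair M h (restrict a h τ u n - uh n) (Wt n - wh n) :=
      (hWt n hn.le).sub (hp n hn.le)
    have p1 : CompactPair M h (restrict a h τ u (n + 1) - uh (n + 1)) (Wt (n + 1) - wh (n + 1)) :=
      (hWt (n + 1) hn).sub (hp (n + 1) hn)
    -- Here the first argument of `Ψ` has the error being estimated. Its source term is bounded by
    -- the mean of the two energies, which adds half of `20B/3` to the growth rate.
    have h1 := energy_timeAvg_le (v := restrict a h τ u - uh) (w := Wt - wh) hμ.le hh p0 p1
    have h2 := (CompactPair.timeAvg (v := restrict a h τ u - uh) (w := Wt - wh) p0 p1).le_energy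
      hμ.le hh
    have h3 : 0 ≤ μ * (h * ∑ p ∈ Finset.Icc (1 : ℤ) M,
        deltaHalf h (timeAvg (restrict a h τ u - uh) n) p ^ 2) := by positivity
    simp only [Pi.sub_apply] at h1
    have h4 := mul_le_mul_of_nonneg_left ((le_add_of_nonneg_right h3).trans (h2.trans h1))
      (by positivity : 0 ≤ 20 * B / 3)
    refine mul_le_mul_of_nonneg_left ?_ hτ.le
    linarith
  · have : τ ^ 4 ≤ (τ ^ 2 + h ^ 4) ^ 2 := by
      rw [show τ ^ 4 = (τ ^ 2) ^ 2 by ring]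
      gcongr
      exact le_add_of_nonneg_right (by positivity)
    have := mul_le_mul_of_nonneg_left this
      (by positivity : 0 ≤ 4 * energyConst μ L B * (2 * (growthConst μ B + 10 * B / 3)) ^ 4)
    linarith

/-- Convergence of the linearized scheme, in terms of the error `G` of the first argument. -/
theorem SolvesScheme.energy_error_le_linearized
    (hs : SolvesScheme μ lam a τ h M N φ v z uh wh)
    (hμ : 0 < μ) (hlam : 0 ≤ lam) (hM : 0 < M) (hh : 0 < h) (hτ : 0 < τ) (hB : 0 ≤ B)
    (hu : BoundedSmoothPeriodic L T B u) (hφ : ∀ x, u x 0 = φ x)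
    (pde : ∀ x : ℝ, ∀ t ∈ Set.Ioc (0 : ℝ) T,
      dt T u x t - μ * dt T (dx 2 u) x t + u x t * dx 1 u x t + dx 1 u x t - lam * dx 2 u x t = 0)
    (hMh : M * h = L) (hN : N * τ = T)
    (hvz : ∀ l ≤ N, CompactPair M h (v l) (z l))
    (hWt : ∀ l ≤ N, CompactPair M h (restrict a h τ u l) (Wt l)) {G : ℝ} (hG0 : 0 ≤ G)
    (hG : ∀ l ≤ N, h * ∑ p ∈ Finset.Icc (1 : ℤ) M, (restrict a h τ u l p - v l p) ^ 2 ≤ G) :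
    ∀ n ≤ N, energy μ M h (restrict a h τ u n - uh n) (Wt n - wh n)
      ≤ 2 * T * Real.exp (4 * growthConst μ B * T)
          * (L * (truncConst μ lam L B * (τ ^ 2 + h ^ 4)) ^ 2 + 20 * B / 3 * G)
        + 4 * energyConst μ L B * (2 * growthConst μ B) ^ 4 * τ ^ 4 := by
  have hL : 0 ≤ L := by rw [← hMh]; positivity
  have hK : 0 ≤ growthConst μ B := by rw [growthConst]; positivity
  refine hs.energy_error_le_of_step hμ hlam hM hh hτ hu hφ hMh hN hvz hWt hK (by positivity)
    fun n hn => ?_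
  refine (hs.energy_error_step hμ hlam hM hh hτ hu pde hMh hN hvz hWt hn).trans ?_
  have := sum_timeAvg_sq_le (M := M) (e := restrict a h τ u - v) (n := n) (G := G) hh (hG n hn.le)
    (hG (n + 1) hn)
  gcongr

end Convergence

/-! ### The interpolated solution -/

section Interpolation

variable {μ lam L T B a h τ A : ℝ} {M N Nc β : ℕ} {φ : ℝ → ℝ} {u : ℝ → ℝ → ℝ}
  {uc wc uf wf : ℕ → ℤ → ℝ}

theorem exists_eq_mul_add {k : ℕ} (hNc : 0 < Nc) (hβ : 0 < β) (hk : k ≤ β * Nc) :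
    ∃ q < Nc, ∃ r ≤ β, k = q * β + r := by
  -- At the final time, division by `β` would give `q = Nc`, which is out of range; the last coarse
  -- interval with `r = β` is used instead.
  rcases hk.eq_or_lt with rfl | hk
  · obtain ⟨n, rfl⟩ := Nat.exists_eq_succ_of_ne_zero hNc.ne'
    exact ⟨n, Nat.lt_succ_self n, β, le_rfl, by rw [Nat.succ_eq_add_one]; ring⟩
  · refine ⟨k / β, Nat.div_lt_of_lt_mul hk, k % β, (Nat.mod_lt _ hβ).le, ?_⟩
    rw [mul_comm]; exact (Nat.div_add_mod k β).symm

theorem StepII.exists_interp (H : StepII L M Nc β uc uf wf) (hM : 0 < M) (hNc : 0 < Nc)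
    (hβ : 0 < β) (hper : ∀ q ≤ Nc, IsPeriodicGrid M (uc q)) {k : ℕ} (hk : k ≤ β * Nc) :
    ∃ q < Nc, ∃ s : ℝ, 0 ≤ s ∧ s ≤ 1 ∧ (k : ℝ) = (q + s) * β ∧
      ∀ p, uf k p = (1 - s) * uc q p + s * uc (q + 1) p := by
  obtain ⟨q, hq, r, hr, rfl⟩ := exists_eq_mul_add hNc hβ hk
  have hβ' : (0 : ℝ) < β := by exact_mod_cast hβ
  refine ⟨q, hq, (r : ℝ) / β, by positivity, ?_, ?_, fun p => ?_⟩
  · rw [div_le_one hβ']; exact_mod_cast hr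
  · push_cast; field_simp
  · exact IsPeriodicGrid.forall_of_forall_mem hM (H.periodic_u _ hk)
      (((hper q hq.le).smul (1 - (r : ℝ) / β)).add ((hper (q + 1) hq).smul ((r : ℝ) / β)))
      (fun p hp => H.interp q hq r hr p hp) p

theorem abs_interp_le {x y s : ℝ} (hx : |x| ≤ A) (hy : |y| ≤ A) (hs0 : 0 ≤ s) (hs1 : s ≤ 1) :
    |(1 - s) * x + s * y| ≤ A := by
  refine (abs_add_le _ _).trans ?_
  rw [abs_mul, abs_mul, abs_of_nonneg hs0, abs_of_nonneg (by linarith : 0 ≤ 1 - s)]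
  nlinarith

/-- The error of the interpolated solution in the discrete `L²` norm. -/
theorem StepII.sum_error_sq_le (H : StepII L M Nc β uc uf wf) (hM : 0 < M) (hNc : 0 < Nc)
    (hβ : 0 < β) (hh : 0 < h) (hMh : M * h = L) (hper : ∀ q ≤ Nc, IsPeriodicGrid M (uc q))
    (hu : BoundedSmoothPeriodic L T B u) {E : ℝ}
    (hE : ∀ q ≤ Nc, h * ∑ p ∈ Finset.Icc (1 : ℤ) M,
      (restrict a h (T / Nc) u q p - uc q p) ^ 2 ≤ E) {k : ℕ} (hk : k ≤ β * Nc) :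
    h * ∑ p ∈ Finset.Icc (1 : ℤ) M, (restrict a h (T / (β * Nc : ℕ)) u k p - uf k p) ^ 2
      ≤ 6 * E + 3 * L * (B * (T / Nc) ^ 2) ^ 2 := by
  obtain ⟨q, hq, s, hs0, hs1, hks, hint⟩ := H.exists_interp hM hNc hβ hper hk
  have hNc' : (0 : ℝ) < Nc := by exact_mod_cast hNc
  have hβ' : (0 : ℝ) < β := by exact_mod_cast hβ
  have hT := hu.pos
  have hτ : 0 < T / Nc := by positivity
  have hN : Nc * (T / Nc) = T := by field_simp
  have h0 := mul_mem_Icc hτ hN hq.le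
  have h1 := mul_mem_Icc hτ hN (Nat.succ_le_of_lt hq)
  have et : (k : ℝ) * (T / (β * Nc : ℕ))
      = (1 - s) * (q * (T / Nc)) + s * (((q + 1 : ℕ) : ℝ) * (T / Nc)) := by
    rw [hks]; push_cast; field_simp; ring
  have hd : ∀ p : ℤ, |restrict a h (T / (β * Nc : ℕ)) u k p
      - ((1 - s) * restrict a h (T / Nc) u q p + s * restrict a h (T / Nc) u (q + 1) p)|
      ≤ B * (T / Nc) ^ 2 := by
    intro p
    have := (hu.timeJet (j := 0) (by omega) (a + p * h)).abs_interp_sub_le h0 h1 hs0 hs1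
    simp only [dx_zero, dtIter, Function.iterate_zero, id] at this
    rw [← et, show ((q + 1 : ℕ) : ℝ) * (T / Nc) - q * (T / Nc) = T / Nc by push_cast; ring] at this
    exact this
  -- The error splits into a convex combination of two coarse errors and the interpolation error of
  -- `u`. Squaring three terms costs a factor `3`, and two coarse levels make `6E`.
  have key : ∀ p ∈ Finset.Icc (1 : ℤ) M,
      (restrict a h (T / (β * Nc : ℕ)) u k p - uf k p) ^ 2
      ≤ 3 * (restrict a h (T / Nc) u q p - uc q p) ^ 2
        + 3 * (restrict a h (T / Nc) u (q + 1) p - uc (q + 1) p) ^ 2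
        + 3 * (B * (T / Nc) ^ 2) ^ 2 := by
    intro p _
    have h2 := sq_le_sq' (abs_le.1 (hd p)).1 (abs_le.1 (hd p)).2
    rw [hint p]
    set X := restrict a h (T / Nc) u q p - uc q p with hX
    set Y := restrict a h (T / Nc) u (q + 1) p - uc (q + 1) p with hY
    set D := restrict a h (T / (β * Nc : ℕ)) u k p
      - ((1 - s) * restrict a h (T / Nc) u q p + s * restrict a h (T / Nc) u (q + 1) p) with hD
    have e : restrict a h (T / (β * Nc : ℕ)) u k p - ((1 - s) * uc q p + s * uc (q + 1) p)
        = (1 - s) * X + s * Y + D := by rw [hX, hY, hD]; ring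
    rw [e]
    have a1 : ((1 - s) * X) ^ 2 ≤ X ^ 2 := by
      rw [mul_pow]; exact mul_le_of_le_one_left (sq_nonneg _) (by nlinarith)
    have a2 : (s * Y) ^ 2 ≤ Y ^ 2 := by
      rw [mul_pow]; exact mul_le_of_le_one_left (sq_nonneg _) (by nlinarith)
    nlinarith [sq_nonneg ((1 - s) * X - s * Y), sq_nonneg ((1 - s) * X - D),
      sq_nonneg (s * Y - D)]
  have h2 := mul_le_mul_of_nonneg_left (Finset.sum_le_sum key) hh.le
  rw [Finset.sum_add_distrib, Finset.sum_add_distrib, ← Finset.mul_sum, ← Finset.mul_sum,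
    Finset.sum_const, nsmul_eq_mul] at h2
  simp only [Int.card_Icc, add_sub_cancel_right, Int.toNat_natCast] at h2
  have h3 := hE q hq.le
  have h4 := hE (q + 1) hq
  rw [← hMh]
  linarith

/-! ### Control of the three norms by the energy. -/

theorem normMax_le (hM : 0 < M) {v : ℤ → ℝ} (hv : ∀ p ∈ Set.Icc (1 : ℤ) M, |v p| ≤ A) :
    normMax M v ≤ A := by
  refine csSup_le (Set.Nonempty.image _ ⟨1, le_rfl, by exact_mod_cast hM⟩) ?_
  rintro _ ⟨p, hp, rfl⟩
  exact hv p hp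

theorem CompactPair.abs_le_sqrt_energy (hμ : 0 < μ) (hL : 0 < L) (hh : 0 < h) (hMh : M * h = L)
    {v w : ℤ → ℝ} (H : CompactPair M h v w) {p : ℤ} (hp : p ∈ Set.Icc (1 : ℤ) M) :
    |v p| ≤ Real.sqrt ((2 + 2 * L ^ 2 / μ) / L * energy μ M h v w) := by
  have h1 := sq_le_of_mem hh v hp
  have h2 := H.le_energy hμ.le hh
  have hd : 0 ≤ h * ∑ p ∈ Finset.Icc (1 : ℤ) M, deltaHalf h v p ^ 2 := by positivity
  have hs : 0 ≤ h * ∑ p ∈ Finset.Icc (1 : ℤ) M, v p ^ 2 := by positivity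
  rw [hMh] at h1
  refine Real.le_sqrt_of_sq_le ?_
  rw [sq_abs, div_mul_eq_mul_div, le_div_iff₀ hL]
  have h3 : h * ∑ p ∈ Finset.Icc (1 : ℤ) M, deltaHalf h v p ^ 2 ≤ energy μ M h v w / μ := by
    rw [le_div_iff₀ hμ]; linarith
  have h4 := mul_le_mul_of_nonneg_left h3 (by positivity : 0 ≤ 2 * L ^ 2)
  have h5 : (2 + 2 * L ^ 2 / μ) * energy μ M h v w
      = 2 * energy μ M h v w + 2 * L ^ 2 * (energy μ M h v w / μ) := by ring
  have h6 : 0 ≤ μ * (h * ∑ p ∈ Finset.Icc (1 : ℤ) M, deltaHalf h v p ^ 2) := by positivity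
  linarith

theorem CompactPair.seminormH1_le (hμ : 0 < μ) (hh : 0 < h) {v w : ℤ → ℝ}
    (H : CompactPair M h v w) : seminormH1 M h v ≤ Real.sqrt (energy μ M h v w / μ) := by
  refine Real.sqrt_le_sqrt ?_
  have h2 := H.le_energy hμ.le hh
  have hs : 0 ≤ h * ∑ p ∈ Finset.Icc (1 : ℤ) M, v p ^ 2 := by positivity
  rw [le_div_iff₀ hμ, gridInner]
  simp only [← pow_two]
  linarith

theorem CompactPair.normL2_le (hμ : 0 < μ) (hh : 0 < h) {v w : ℤ → ℝ}
    (H : CompactPair M h v w) : normL2 M h v ≤ Real.sqrt (energy μ M h v w) := by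
  refine Real.sqrt_le_sqrt ?_
  have h2 := H.le_energy hμ.le hh
  have hs : 0 ≤ μ * (h * ∑ p ∈ Finset.Icc (1 : ℤ) M, deltaHalf h v p ^ 2) := by positivity
  rw [gridInner]
  simp only [← pow_two]
  linarith

/-! ### Grid-independent bounds for the rough solution. -/

theorem StepII.compactPair (H : StepII L M Nc β uc uf wf) (hM : 0 < M) (hL : 0 < L) {k : ℕ}
    (hk : k ≤ β * Nc) : CompactPair M (L / M) (uf k) (wf k) :=
  .of_compactRelation hM (by have : (0 : ℝ) < M := by exact_mod_cast hM
                             positivity) (H.periodic_u k hk) (H.periodic_w k hk) (H.compact k hk)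

/-- `|δ_xx v| ≤ 4A/h²`, and the maximum principle multiplies by `3/2`; this is the origin of the
factor `6/h²` in the admissibility condition. -/
theorem CompactPair.abs_right_le (hM : 0 < M) (hh : 0 < h) {v w : ℤ → ℝ}
    (H : CompactPair M h v w) (hv : ∀ p, |v p| ≤ A) (p : ℤ) : |w p| ≤ 6 / h ^ 2 * A := by
  have := abs_le_of_abs_compactOp_le hM hh H.periodic_right (c := 4 / h ^ 2 * A) (fun q => by
    rw [H.compactOp_right, deltaXX_eq, abs_div, abs_of_pos (by positivity : 0 < h ^ 2),
      div_mul_eq_mul_div]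
    gcongr
    have h1 := abs_le.1 (hv (q + 1))
    have h2 := abs_le.1 (hv q)
    have h3 := abs_le.1 (hv (q - 1))
    rw [abs_le]
    constructor <;> linarith [h1.1, h1.2, h2.1, h2.2, h3.1, h3.2]) p
  refine this.trans_eq ?_
  ring

/-- The errors of the interpolated solution are bounded independently of the grid. -/
theorem StepII.roughErrorBound (H : StepII L M Nc β uc uf wf) (hM : 0 < M) (hNc : 0 < Nc)
    (hβ : 0 < β) (hL : 0 < L) (hper : ∀ q ≤ Nc, IsPeriodicGrid M (uc q))
    (hu : BoundedSmoothPeriodic L T B u) (hB : 0 ≤ B)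
    (hA : ∀ q ≤ Nc, ∀ p, |uc q p| ≤ A) :
    RoughErrorBound L T a u M Nc β uf wf (A + B + B * L ^ 2 / 6) := by
  intro k hk
  obtain ⟨q, hq, s, hs0, hs1, -, hint⟩ := H.exists_interp hM hNc hβ hper hk
  have hM' : (1 : ℝ) ≤ M := by exact_mod_cast hM
  have hNc' : (0 : ℝ) < Nc := by exact_mod_cast hNc
  have hβ' : (0 : ℝ) < β := by exact_mod_cast hβ
  have hh : 0 < L / M := by positivity
  have hhL : L / M ≤ L := div_le_self hL.le hM'
  have hT := hu.pos
  have hk' : (k : ℝ) * (T / (β * Nc : ℕ)) ∈ Set.Icc 0 T :=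
    mul_mem_Icc (by push_cast; positivity) (by push_cast; field_simp) hk
  have huf : ∀ p, |uf k p| ≤ A := fun p => by
    rw [hint]; exact abs_interp_le (hA q hq.le p) (hA (q + 1) hq p) hs0 hs1
  have hwf := (H.compactPair hM hL hk).abs_right_le hM hh huf
  refine ⟨normMax_le hM fun p _ => ?_, normMax_le hM fun p _ => ?_⟩
  · have h1 := hu.abs_restrict_le (a := a) (h := L / M) hk' p
    have h2 : 0 ≤ B * L ^ 2 / 6 := by positivity
    rw [Pi.sub_apply]
    linarith [abs_sub (restrict a (L / M) (T / (β * Nc : ℕ)) u k p) (uf k p), huf p]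
  · have h1 : |restrict a (L / M) (T / (β * Nc : ℕ)) (dx 2 u) k p| ≤ B :=
      hu.bound 0 (by omega) 2 (by omega) (a + p * (L / M)) _ hk'
    -- Since `h ≤ L`, the bound for `u_xx` can be written with the prescribed factor `6/h²`.
    have h2 : B ≤ 6 / (L / M) ^ 2 * (B * L ^ 2 / 6) := by
      rw [div_mul_eq_mul_div, le_div_iff₀ (by positivity)]
      have : (L / M) ^ 2 ≤ L ^ 2 := by gcongr
      nlinarith
    have h3 : 0 ≤ 6 / (L / M) ^ 2 * B := by positivity
    rw [Pi.sub_apply]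
    refine (abs_sub _ _).trans ((add_le_add h1 (hwf p)).trans ?_)
    linarith

end Interpolation

end BBMB

/-! ### Assembly of the two-grid estimate. -/

theorem mainTheorem1 (μ lam L T a : ℝ) (hμ : 0 < μ) (hlam : 0 < lam) (hL : 0 < L) (hT : 0 < T)
    (φ : ℝ → ℝ) (u : ℝ → ℝ → ℝ) (hu : BBMB.IsSmoothSolution μ lam L T φ u) :
    -- the constant entering `C₃` exists, independently of the grid
    (∃ Ct : ℝ, 0 < Ct ∧
      ∀ (M Nc β : ℕ), 1 ≤ M → 1 ≤ Nc → 1 ≤ β →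
      ∀ uc wc uf wf : ℕ → ℤ → ℝ,
        BBMB.StepI μ lam L T a φ M Nc uc wc →
        BBMB.StepII L M Nc β uc uf wf →
        BBMB.RoughErrorBound L T a u M Nc β uf wf Ct) ∧
    -- convergence of Step III, for every admissible choice of that constant
    (∀ Ct : ℝ, 0 < Ct →
      ∃ C : ℝ, 0 < C ∧
        ∀ (M Nc β : ℕ), 1 ≤ M → 1 ≤ Nc → 1 ≤ β →
        ∀ uc wc uf wf uh wh : ℕ → ℤ → ℝ,
          BBMB.StepI μ lam L T a φ M Nc uc wc →
          BBMB.StepII L M Nc β uc uf wf →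
          BBMB.StepIII μ lam L T a φ M Nc β uf wf uh wh →
          BBMB.RoughErrorBound L T a u M Nc β uf wf Ct →
          ∀ h τc τf : ℝ, h = L / M → τc = T / Nc → τf = T / (β * Nc : ℕ) →
          2 * τf * BBMB.constC3 L μ lam (BBMB.constC0 T u) Ct < 1 / 3 →
          ∀ k ≤ β * Nc,
            BBMB.seminormH1 M h (BBMB.restrict a h τf u k - uh k)
                ≤ C * (τc ^ 2 + τf ^ 2 + h ^ 4) ∧
            BBMB.normL2 M h (BBMB.restrict a h τf u k - uh k)
                ≤ L * C / Real.sqrt 6 * (τc ^ 2 + τf ^ 2 + h ^ 4) ∧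
            BBMB.normMax M (BBMB.restrict a h τf u k - uh k)
                ≤ C * Real.sqrt L / 2 * (τc ^ 2 + τf ^ 2 + h ^ 4)) := by
  open BBMB in
  have hsp := hu.smoothPeriodic hT
  obtain ⟨B, hB0, hBd⟩ := hsp.exists_bound hL hT
  have hb : BoundedSmoothPeriodic L T B u := ⟨hsp, hT, hBd⟩
  have hS : 0 ≤ energyConst μ L B := by rw [energyConst]; positivity
  -- The square root bounds the coarse solution in maximum norm through stability and the Sobolev
  -- inequality; `B` accounts for `u`, and `B L²/6` for `u_xx`.
  refine ⟨⟨Real.sqrt ((2 + 2 * L ^ 2 / μ) / L * energyConst μ L B) + B + B * L ^ 2 / 6,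
    by positivity, ?_⟩, fun Ct _ => ?_⟩
  · intro M Nc β hM hNc hβ uc wc uf wf hI hII
    have hM' : (0 : ℝ) < M := by exact_mod_cast hM
    have hNc' : (0 : ℝ) < Nc := by exact_mod_cast hNc
    have hh : 0 < L / M := by positivity
    have hMh : M * (L / M) = L := by field_simp
    refine hII.roughErrorBound hM hNc hβ hL hI.periodic_u hb hB0.le fun q hq p => ?_
    have hp : ∀ l ≤ Nc, CompactPair M (L / M) (uc l) (wc l) := fun l hl =>
      SolvesScheme.compactPair hI hM hh hl
    obtain ⟨p', hp', hpp⟩ := IsPeriodicGrid.exists_mem hM p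
    rw [hpp _ (hI.periodic_u q hq)]
    refine ((hp q hq).abs_le_sqrt_energy hμ hL hh hMh hp').trans (Real.sqrt_le_sqrt ?_)
    gcongr
    exact SolvesScheme.energy_le hI hμ.le hlam.le hM hh (by positivity) hb hu.initial hMh hp q hq
  -- Relative to the squared rate, `C₁` bounds the coarse error energy, `C₂` the squared `L²` error
  -- of the interpolant, and `C₃` the fine error energy. This `C₃` is not `constC3`.
  · set C₁ := 2 * T * Real.exp (4 * (growthConst μ B + 10 * B / 3) * T)
          * (L * truncConst μ lam L B ^ 2)
        + 4 * energyConst μ L B * (2 * (growthConst μ B + 10 * B / 3)) ^ 4 with hC₁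
    set C₂ := 6 * C₁ + 3 * L * B ^ 2 with hC₂
    set C₃ := 2 * T * Real.exp (4 * growthConst μ B * T)
          * (L * truncConst μ lam L B ^ 2 + 20 * B / 3 * C₂)
        + 4 * energyConst μ L B * (2 * growthConst μ B) ^ 4 with hC₃
    have hK : 0 ≤ growthConst μ B := by rw [growthConst]; positivity
    have hC₁0 : 0 ≤ C₁ := by positivity
    have hC₂0 : 0 ≤ C₂ := by positivity
    have hC₃0 : 0 ≤ C₃ := by positivity
    set D₁ := Real.sqrt (C₃ / μ)
    set D₂ := Real.sqrt C₃
    set D₃ := Real.sqrt ((2 + 2 * L ^ 2 / μ) / L * C₃)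
    have hs6 : 0 < Real.sqrt 6 := by positivity
    have hsL : 0 < Real.sqrt L := by positivity
    -- One `C` serves all three norms: each summand undoes the weight prescribed in its estimate,
    -- and `1` ensures positivity.
    set C := D₁ + D₂ * Real.sqrt 6 / L + 2 * D₃ / Real.sqrt L + 1 with hC
    have hD₁ : 0 ≤ D₁ := Real.sqrt_nonneg _
    have hD₂ : 0 ≤ D₂ * Real.sqrt 6 / L := by positivity
    have hD₃ : 0 ≤ 2 * D₃ / Real.sqrt L := by positivity
    have hCD₁ : D₁ ≤ C := by linarith
    have hCD₂ : D₂ ≤ L * C / Real.sqrt 6 := by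
      rw [le_div_iff₀ hs6, ← div_le_iff₀' hL]; linarith
    have hCD₃ : D₃ ≤ C * Real.sqrt L / 2 := by
      rw [le_div_iff₀ (by norm_num), ← div_le_iff₀ hsL, mul_comm D₃]; linarith
    refine ⟨C, by linarith, ?_⟩
    rintro M Nc β hM hNc hβ uc wc uf wf uh wh hI hII hIII - h τc τf rfl rfl rfl - k hk
    have hM' : (0 : ℝ) < M := by exact_mod_cast hM
    have hNc' : (0 : ℝ) < Nc := by exact_mod_cast hNc
    have hβ' : (0 : ℝ) < β := by exact_mod_cast hβ
    set h := L / M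
    have hh : 0 < h := by positivity
    have hMh : M * h = L := by simp only [h]; field_simp
    have hτc : 0 < T / Nc := by positivity
    have hτf : 0 < T / (β * Nc : ℕ) := by push_cast; positivity
    have hNτc : Nc * (T / Nc) = T := by field_simp
    have hNτf : (β * Nc : ℕ) * (T / (β * Nc : ℕ)) = T := by push_cast; field_simp
    have hpc : ∀ l ≤ Nc, CompactPair M h (uc l) (wc l) := fun l hl =>
      SolvesScheme.compactPair hI hM hh hl
    have hpf : ∀ l ≤ β * Nc, CompactPair M h (uf l) (wf l) := fun l hl => hII.compactPair hM hL hl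
    have hex : ∀ (τ : ℝ) (N : ℕ), 0 < τ → N * τ = T →
        ∃ W : ℕ → ℤ → ℝ, ∀ l ≤ N, CompactPair M h (restrict a h τ u l) (W l) := by
      intro τ N hτ hN
      have : ∀ l, ∃ w, l ≤ N → CompactPair M h (restrict a h τ u l) w := by
        intro l
        by_cases hl : l ≤ N
        · obtain ⟨w, hw⟩ := exists_compactPair hM hh
            (BoundedSmoothPeriodic.isPeriodicGrid_restrict (a := a) hsp hMh (mul_mem_Icc hτ hN hl))
          exact ⟨w, fun _ => hw⟩
        · exact ⟨0, fun hl' => absurd hl' hl⟩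
      choose W hW using this
      exact ⟨W, hW⟩
    obtain ⟨Wc, hWc⟩ := hex _ Nc hτc hNτc
    obtain ⟨Wf, hWf⟩ := hex _ (β * Nc) hτf hNτf
    have hE : ∀ q ≤ Nc, h * ∑ p ∈ Finset.Icc (1 : ℤ) M, (restrict a h (T / Nc) u q p - uc q p) ^ 2
        ≤ C₁ * ((T / Nc) ^ 2 + h ^ 4) ^ 2 := by
      intro q hq
      have h1 := SolvesScheme.energy_error_le_nonlinear hI hμ hlam.le hM hh hτc hB0.le hb hu.initial
        hu.pde hMh hNτc hWc q hq
      have h2 := ((hWc q hq).sub (hpc q hq)).le_energy hμ.le hh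
      have h3 : 0 ≤ μ * (h * ∑ p ∈ Finset.Icc (1 : ℤ) M,
        deltaHalf h (restrict a h (T / Nc) u q - uc q) p ^ 2) := by positivity
      exact ((le_add_of_nonneg_right h3).trans h2).trans h1
    have hG : ∀ l ≤ β * Nc, h * ∑ p ∈ Finset.Icc (1 : ℤ) M,
        (restrict a h (T / (β * Nc : ℕ)) u l p - uf l p) ^ 2
        ≤ C₂ * ((T / Nc) ^ 2 + h ^ 4) ^ 2 := by
      intro l hl
      refine (hII.sum_error_sq_le hM hNc hβ hh hMh hI.periodic_u hb hE hl).trans ?_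
      have h1 : ((T / Nc) ^ 2) ^ 2 ≤ ((T / Nc) ^ 2 + h ^ 4) ^ 2 := by
        gcongr; exact le_add_of_nonneg_right (by positivity)
      have h2 := mul_le_mul_of_nonneg_left h1 (by positivity : 0 ≤ 3 * L * B ^ 2)
      rw [hC₂]
      linarith
    have hfin := SolvesScheme.energy_error_le_linearized hIII hμ hlam.le hM hh hτf hB0.le hb
      hu.initial hu.pde hMh hNτf hpf hWf (by positivity) hG k hk
    set τc := T / (Nc : ℝ)
    set τf := T / ((β * Nc : ℕ) : ℝ)
    set ρ := τc ^ 2 + τf ^ 2 + h ^ 4 with hρ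
    have hρ0 : 0 ≤ ρ := by positivity
    have hρ1 : (τf ^ 2 + h ^ 4) ^ 2 ≤ ρ ^ 2 := by
      rw [hρ]; gcongr; linarith [sq_nonneg τc]
    have hρ2 : (τc ^ 2 + h ^ 4) ^ 2 ≤ ρ ^ 2 := by
      rw [hρ]; gcongr; linarith [sq_nonneg τf]
    have hρ3 : τf ^ 4 ≤ ρ ^ 2 := by
      rw [show τf ^ 4 = (τf ^ 2) ^ 2 by ring, hρ]
      gcongr
      linarith [sq_nonneg τc, (by positivity : 0 ≤ h ^ 4)]
    have hen : energy μ M h (restrict a h τf u k - uh k) (Wf k - wh k) ≤ C₃ * ρ ^ 2 := by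
      refine hfin.trans ?_
      rw [mul_pow]
      calc _ ≤ 2 * T * Real.exp (4 * growthConst μ B * T)
            * (L * (truncConst μ lam L B ^ 2 * ρ ^ 2) + 20 * B / 3 * (C₂ * ρ ^ 2))
            + 4 * energyConst μ L B * (2 * growthConst μ B) ^ 4 * ρ ^ 2 := by gcongr
        _ = _ := by rw [hC₃]; ring
    have hpair := (hWf k hk).sub (SolvesScheme.compactPair hIII hM hh hk)
    have hsq : ∀ c : ℝ, Real.sqrt (c * ρ ^ 2) = Real.sqrt c * ρ := fun c => by
      rw [Real.sqrt_mul' _ (sq_nonneg ρ), Real.sqrt_sq hρ0]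
    refine ⟨(hpair.seminormH1_le hμ hh).trans ?_, (hpair.normL2_le hμ hh).trans ?_,
      (normMax_le hM fun p hp => hpair.abs_le_sqrt_energy hμ hL hh hMh hp).trans ?_⟩
    · refine (Real.sqrt_le_sqrt (div_le_div_of_nonneg_right hen hμ.le)).trans ?_
      rw [mul_div_right_comm, hsq]
      gcongr
    · refine (Real.sqrt_le_sqrt hen).trans ?_
      rw [hsq]
      gcongr
    · refine (Real.sqrt_le_sqrt (mul_le_mul_of_nonneg_left hen (by positivity))).trans ?_
      rw [← mul_assoc, hsq]
      gcongr

end
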